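/- There is a universal constant $C>0$ such that the following holds. Let $H=\sum_{a=1}^{L}H_a$ be a Hamiltonian on $n$ qubits, where each Hermitian term $H_a$ acts non-trivially on at most $k$ qubits, has operator norm $\|H_a\|\le J$, and has real non-positive off-diagonal entries in the computational basis (that is, $H$ is $k$-local and stoquastic). Suppose that the energy gap of $H$ above its (possibly degenerate) ground energy $E_0$ is at least $\Delta>0$, i.e. every eigenvalue of $H$ other than $E_0$ is at least $E_0+\Delta$. Let $|+\rangle=2^{-n/2}\sum_{x\in\{0,1\}^n}|x\rangle$, let $\Pi$ be the orthogonal projection onto the ground subspace of $H$, assume $\eta=\sqrt{\langle +|\Pi|+\rangle}>0$, and let $|\psi_0\rangle=\frac1\eta\Pi|+\rangle$. Let $0<\varepsilon\le 1$ and put $$B=\eta^{-1/2}L^{5/2}J^{3/2}\Delta^{-3/2}\varepsilon^{-1/2}\bigl(\log(\eta^{-1}\varepsilon^{-1})\bigr)^{3/2}.$$ A Hyper Boltzmann Machine (HBM) with $n$ visible and $m$ hidden nodes consists of a finite set $E$ of hyperedges, each a set of nodes, and, for each $e\in E$, a function $F_e:\{0,1\}^e\to\mathbb R$. With $F=\sum_{e\in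 E}F_e$, its output is $f(x)=\sum_{h\in\{0,1\}^m}\exp(-F(x,h))$ for $x\in\{0,1\}^n$. It is $k'$-local if every hyperedge contains at most $k'$ nodes. It represents a state $|\psi\rangle$ to precision $\varepsilon$ in distribution if $$\frac12\sum_{x\in\{0,1\}^n}\left|\frac{f(x)}{\sum_y f(y)}-|\langle x|\psi\rangle|^2\right|\le\varepsilon .$$ Then $|\psi_0\rangle$ is represented to precision $\varepsilon$ in distribution by a $2k$-local HBM with $n$ visible nodes, at most $C\,k\,B$ hidden nodes and at most $C\,B$ hyperedges, in which each node (visible or hidden) is contained in at most 2 hyperedges. -/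

import Mathlib

open scoped BigOperators

noncomputable section

namespace StoqHBM

/-- The Hilbert space of `n` qubits, with computational basis indexed by bit strings. -/
abbrev QubitSpace (n : ℕ) : Type := EuclideanSpace ℂ (Fin n → Bool)

/-- Operators on `n` qubits, as matrices in the computational basis. -/
abbrev QubitOp (n : ℕ) : Type := Matrix (Fin n → Bool) (Fin n → Bool) ℂ

/-- The operator norm with respect to the Hilbert space norm. -/
def opNorm {n : ℕ} (A : QubitOp n) : ℝ := ‖Matrix.toEuclideanCLM (𝕜 := ℂ) A‖

/-- `A` acts non-trivially only on the qubits in `S`: it is of the form `B ⊗ 1`, where `B` acts on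
the qubits in `S` and the identity acts on all other qubits. -/
def ActsOn {n : ℕ} (S : Finset (Fin n)) (A : QubitOp n) : Prop :=
  ∃ B : Matrix ({i // i ∈ S} → Bool) ({i // i ∈ S} → Bool) ℂ, ∀ x y : Fin n → Bool,
    A x y = if ∀ i, i ∉ S → x i = y i then B (fun i => x i.1) (fun i => y i.1) else 0

/-- A `k`-local Hamiltonian on `n` qubits with `L` terms. -/
structure LocalHamiltonian (n k L : ℕ) where
  /-- the local terms -/
  term : Fin L → QubitOp n
  isHermitian : ∀ a, (term a).IsHermitian
  isLocal : ∀ a, ∃ S : Finset (Fin n), S.card ≤ k ∧ ActsOn S (term a)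

namespace LocalHamiltonian

variable {n k L : ℕ}

/-- The Hamiltonian itself, the sum of its terms. -/
def toOp (H : LocalHamiltonian n k L) : QubitOp n := ∑ a, H.term a

/-- Every term has real non-positive off-diagonal entries in the computational basis. -/
def IsStoquastic (H : LocalHamiltonian n k L) : Prop :=
  ∀ a, ∀ x y : Fin n → Bool, x ≠ y → (H.term a x y).im = 0 ∧ (H.term a x y).re ≤ 0

/-- The set of energy levels: the (real) eigenvalues of the Hamiltonian. -/
def energies (H : LocalHamiltonian n k L) : Set ℝ :=
  {E : ℝ | Module.End.HasEigenvalue (Matrix.toEuclideanLin (𝕜 := ℂ) H.toOp) (E : ℂ)}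

/-- The ground energy: the least eigenvalue (the set of eigenvalues is finite and non-empty). -/
def groundEnergy (H : LocalHamiltonian n k L) : ℝ := sInf H.energies

/-- The spectrum has a gap of at least `Δ > 0` above the ground energy. The ground energy may be
degenerate. -/
def HasGap (H : LocalHamiltonian n k L) (Δ : ℝ) : Prop :=
  0 < Δ ∧ ∀ E ∈ H.energies, E ≠ H.groundEnergy → H.groundEnergy + Δ ≤ E

/-- The ground subspace: the eigenspace of the ground energy. -/
def groundSpace (H : LocalHamiltonian n k L) : Submodule ℂ (QubitSpace n) :=
  Module.End.eigenspace (Matrix.toEuclideanLin (𝕜 := ℂ) H.toOp) (H.groundEnergy : ℂ)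

/-- The orthogonal projection `Π` onto the ground subspace. -/
def groundProj (H : LocalHamiltonian n k L) : QubitSpace n →L[ℂ] QubitSpace n :=
  H.groundSpace.starProjection

end LocalHamiltonian

/-- The uniform superposition `|+⟩` of all `2 ^ n` basis states. -/
def plusState (n : ℕ) : QubitSpace n :=
  WithLp.toLp 2 (fun _ => ((1 / Real.sqrt (2 ^ n) : ℝ) : ℂ))

namespace LocalHamiltonian

variable {n k L : ℕ}

/-- `η = √⟨+|Π|+⟩`. -/
def overlap (H : LocalHamiltonian n k L) : ℝ :=
  Real.sqrt (inner ℂ (plusState n) (H.groundProj (plusState n))).re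

/-- The ground state `|ψ₀⟩ = (1 / η) Π|+⟩`. -/
def groundState (H : LocalHamiltonian n k L) : QubitSpace n :=
  ((1 / H.overlap : ℝ) : ℂ) • H.groundProj (plusState n)

end LocalHamiltonian

/-- A Hyper Boltzmann Machine with `n` visible nodes (left summand) and `m` hidden nodes (right
summand): a hypergraph on these nodes together with, for each hyperedge `e`, a real local energy
term, a function of the bits carried by the nodes of `e`. -/
structure HBM (n m : ℕ) where
  /-- the hyperedges -/
  edges : Finset (Finset (Fin n ⊕ Fin m))
  /-- the local energy terms -/
  localEnergy : (e : edges) → ({v // v ∈ e.1} → Bool) → ℝ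

namespace HBM

variable {n m : ℕ}

/-- Every hyperedge contains at most `k` nodes. -/
def IsLocal (M : HBM n m) (k : ℕ) : Prop := ∀ e ∈ M.edges, e.card ≤ k

/-- The number of hyperedges containing a node. -/
def degree (M : HBM n m) (v : Fin n ⊕ Fin m) : ℕ := (M.edges.filter (fun e => v ∈ e)).card

/-- The total energy of a configuration `x` of the visible and `h` of the hidden nodes. -/
def energy (M : HBM n m) (x : Fin n → Bool) (h : Fin m → Bool) : ℝ :=
  ∑ e : M.edges, M.localEnergy e (fun v => Sum.elim x h v.1)

/-- The output of the machine, a function on configurations of the visible nodes. -/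
def output (M : HBM n m) (x : Fin n → Bool) : ℝ :=
  ∑ h : Fin m → Bool, Real.exp (-M.energy x h)

/-- The machine represents the state `ψ` to precision `ε` in distribution: the total variation
distance between its normalized output and the distribution of `ψ` is at most `ε`. -/
def RepresentsInDistribution (M : HBM n m) (ψ : QubitSpace n) (ε : ℝ) : Prop :=
  (1 / 2 : ℝ) * ∑ x : Fin n → Bool, |M.output x / (∑ y, M.output y) - ‖ψ x‖ ^ 2| ≤ ε

end HBM

/-- `η^{-1/2} L^{5/2} J^{3/2} Δ^{-3/2} ε^{-1/2} (log (η⁻¹ ε⁻¹))^{3/2}`. -/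
def sizeBound (η : ℝ) (L : ℕ) (J Δ ε : ℝ) : ℝ :=
  η ^ (-(1 / 2) : ℝ) * (L : ℝ) ^ (5 / 2 : ℝ) * J ^ (3 / 2 : ℝ) * Δ ^ (-(3 / 2) : ℝ) *
    ε ^ (-(1 / 2) : ℝ) * (Real.log (η⁻¹ * ε⁻¹)) ^ (3 / 2 : ℝ)

end StoqHBM

end

/-! Ground states are reached by imaginary time evolution of `|+⟩`. Stoquasticity makes every `J -
Hₐ` entrywise non-negative: off the diagonal by hypothesis, on it because `‖Hₐ‖ ≤ J`. Hence the
quadratic Taylor polynomial of `exp ((τ / 2) (J - Hₐ))` is a local gate with non-negative entries.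
The palindromic product of these gates agrees with the quadratic Taylor polynomial of `exp (τ (L J -
H))` up to `(2 L J τ) ^ 3` (`isQuadApprox_palindrome`). The latter is a function of `H`: divided by
its top eigenvalue, its `r`-th power converges to `Π` at rate `exp (-r τ Δ / 3)`
(`norm_normalized_quadExp_pow_sub_groundProj_le`), so no operator exponential is needed.

Applied to `|+⟩`, the gates form a tensor network of non-negative factors. Each gate touches at most
`2 k` variables and turns the variables it consumes into hidden ones, which lie in exactly the gates
on either side (`HasFactorGraph.apply`). The probabilities are squares of the amplitudes, hence two
copies of the network sharing the visible variables; each copy uses a visible variable at most once,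
so all degrees are at most 2. Logarithms of the factors, made strictly positive by a small
perturbation, are the local energies.

With `z = L J l / Δ`, `l = log (1 / (η ε))`, a total time of order `l / Δ` suffices for the
projection, and `r` steps cost an error of order `z ^ 3 / r ^ 2`. Requiring this to be below `η ε`
gives `r` of order `z ^ (3 / 2) (η ε) ^ (-1 / 2)`, and there are `4 L r` factors. As `l` may vanish,
states within `ε` of `|+⟩` are treated separately, by the machine without hyperedges. -/

namespace StoqHBM

/-! ### Second-order symmetric product formula with an explicit cubic remainder -/

section QuadraticApproximation

/-- `1 + X + X ^ 2 / 2`, the quadratic Taylor polynomial of the exponential. -/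
def quadExp (𝕜 : Type*) {R : Type*} [Field 𝕜] [Ring R] [Algebra 𝕜 R] (X : R) : R :=
  1 + X + (2⁻¹ : 𝕜) • (X * X)

lemma quadExp_real (x : ℝ) : quadExp ℝ x = 1 + x + x ^ 2 / 2 := by
  simp only [quadExp, smul_eq_mul]; ring

/-- `U` agrees with `1 + M + N` up to the cubic remainder of `exp x`, where `M` and `N` are bounded
by the linear and the quadratic term of `exp x`. -/
structure IsQuadApprox {𝔸 : Type*} [NormedRing 𝔸] (U M N : 𝔸) (x : ℝ) : Prop where
  norm_linear : ‖M‖ ≤ x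
  norm_quadratic : ‖N‖ ≤ x ^ 2 / 2
  norm_sub : ‖U - (1 + M + N)‖ ≤ Real.exp x - (1 + x + x ^ 2 / 2)

variable {𝔸 : Type*} [NormedRing 𝔸]

lemma IsQuadApprox.nonneg {U M N : 𝔸} {x : ℝ} (h : IsQuadApprox U M N x) : 0 ≤ x :=
  (norm_nonneg _).trans h.norm_linear

variable [NormOneClass 𝔸]

lemma IsQuadApprox.norm_poly {U M N : 𝔸} {x : ℝ} (h : IsQuadApprox U M N x) :
    ‖1 + M + N‖ ≤ 1 + x + x ^ 2 / 2 := by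
  refine (norm_add_le _ _).trans (add_le_add ((norm_add_le _ _).trans ?_) h.norm_quadratic)
  rw [norm_one]
  exact add_le_add le_rfl h.norm_linear

lemma IsQuadApprox.norm_le {U M N : 𝔸} {x : ℝ} (h : IsQuadApprox U M N x) : ‖U‖ ≤ Real.exp x := by
  have h1 := norm_add_le (U - (1 + M + N)) (1 + M + N)
  rw [sub_add_cancel] at h1
  linarith [h.norm_sub, h.norm_poly]

/-- Scalar majorization: every term of degree at least three in the product is bounded by the
matching term of `exp x * exp y`, so the remainders combine exactly to that of `exp (x + y)`. -/
lemma IsQuadApprox.mul {U M N U' M' N' : 𝔸} {x y : ℝ} (h : IsQuadApprox U M N x)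
    (h' : IsQuadApprox U' M' N' y) :
    IsQuadApprox (U * U') (M + M') (N + M * M' + N') (x + y) := by
  have hx := h.nonneg
  have hy := h'.nonneg
  have mul_bd : ∀ {a b : 𝔸} {s t : ℝ}, ‖a‖ ≤ s → ‖b‖ ≤ t → ‖a * b‖ ≤ s * t := fun ha hb =>
    (norm_mul_le _ _).trans (mul_le_mul ha hb (norm_nonneg _) ((norm_nonneg _).trans ha))
  refine ⟨(norm_add_le _ _).trans (add_le_add h.norm_linear h'.norm_linear), ?_, ?_⟩
  · have h1 := norm_add₃_le (a := N) (b := M * M') (c := N')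
    have h2 := mul_bd h.norm_linear h'.norm_linear
    linarith [h.norm_quadratic, h'.norm_quadratic]
  · have key : U * U' - (1 + (M + M') + (N + M * M' + N')) =
        M * N' + N * M' + N * N' + (U - (1 + M + N)) * U'
          + (1 + M + N) * (U' - (1 + M' + N')) := by noncomm_ring
    rw [key]
    have e1 := mul_bd h.norm_linear h'.norm_quadratic
    have e2 := mul_bd h.norm_quadratic h'.norm_linear
    have e3 := mul_bd h.norm_quadratic h'.norm_quadratic
    have e4 := mul_bd h.norm_sub h'.norm_le
    have e5 := mul_bd h.norm_poly h'.norm_sub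
    have t1 := norm_add_le (M * N' + N * M' + N * N' + (U - (1 + M + N)) * U')
      ((1 + M + N) * (U' - (1 + M' + N')))
    have t2 := norm_add_le (M * N' + N * M' + N * N') ((U - (1 + M + N)) * U')
    have t3 := norm_add₃_le (a := M * N') (b := N * M') (c := N * N')
    rw [Real.exp_add]
    nlinarith

lemma isQuadApprox_quadExp {𝔸 : Type*} [NormedRing 𝔸] [NormedAlgebra ℂ 𝔸] {X : 𝔸} {x : ℝ} (h : ‖X‖ ≤ x) :
    IsQuadApprox (quadExp ℂ X) X ((2⁻¹ : ℂ) • (X * X)) x := by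
  have hx : 0 ≤ x := (norm_nonneg _).trans h
  refine ⟨h, ?_, ?_⟩
  · rw [norm_smul]
    have h1 : ‖X * X‖ ≤ x * x := (norm_mul_le _ _).trans (mul_self_le_mul_self (norm_nonneg _) h)
    norm_num
    linarith
  · rw [quadExp, sub_self, norm_zero, sub_nonneg]
    exact Real.quadratic_le_exp_of_nonneg hx

/-- The palindromic product `G a₁ ⋯ G aₗ G aₗ ⋯ G a₁`. -/
def palindrome {α R : Type*} [Monoid R] (G : α → R) : List α → R
  | [] => 1
  | a :: l => G a * palindrome G l * G a

lemma map_palindrome {α R R' : Type*} [Monoid R] [Monoid R'] (φ : R →* R') (G : α → R)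
    (l : List α) : φ (palindrome G l) = palindrome (fun a => φ (G a)) l := by
  induction l with
  | nil => simp [palindrome]
  | cons a l ih => simp [palindrome, ih]

/-- The mirror symmetry makes `X a * X b` and `X b * X a` occur with equal weight. The second-order
part is therefore exactly half the square of the linear part, without commutator terms. -/
lemma isQuadApprox_palindrome [NormedAlgebra ℂ 𝔸] {α : Type*} (X : α → 𝔸) {x : ℝ} (hX : ∀ a, ‖X a‖ ≤ x) (l : List α) :
    IsQuadApprox (palindrome (fun a => quadExp ℂ (X a)) l) ((2 : ℂ) • (l.map X).sum)
      ((2⁻¹ : ℂ) • (((2 : ℂ) • (l.map X).sum) * ((2 : ℂ) • (l.map X).sum))) (2 * l.length * x) := by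
  induction l with
  | nil => constructor <;> simp [palindrome]
  | cons a l ih =>
    have h := ((isQuadApprox_quadExp (hX a)).mul ih).mul (isQuadApprox_quadExp (hX a))
    set Y := (l.map X).sum with hY
    have e1 : X a + (2 : ℂ) • Y + X a = (2 : ℂ) • ((a :: l).map X).sum := by
      rw [List.map_cons, List.sum_cons, ← hY]; module
    have e2 : (2⁻¹ : ℂ) • (X a * X a) + X a * (2 : ℂ) • Y
        + (2⁻¹ : ℂ) • (((2 : ℂ) • Y) * ((2 : ℂ) • Y)) + (X a + (2 : ℂ) • Y) * X a
        + (2⁻¹ : ℂ) • (X a * X a) =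
        (2⁻¹ : ℂ) • (((2 : ℂ) • ((a :: l).map X).sum) * ((2 : ℂ) • ((a :: l).map X).sum)) := by
      rw [List.map_cons, List.sum_cons, ← hY]
      simp only [mul_smul_comm, smul_mul_assoc, mul_add, add_mul, smul_add]
      module
    have e3 : x + 2 * (l.length : ℝ) * x + x = 2 * ((a :: l).length : ℝ) * x := by
      rw [List.length_cons]; push_cast; ring
    rw [e1, e2, e3] at h
    exact h

lemma norm_pow_sub_pow_le {S P : 𝔸} {c : ℝ} (hP : ‖P‖ ≤ 1) (h : ‖S - P‖ ≤ c) (r : ℕ) :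
    ‖S ^ r - P ^ r‖ ≤ (1 + c) ^ r - 1 := by
  have hc : 0 ≤ c := (norm_nonneg _).trans h
  have hS : ‖S‖ ≤ 1 + c := by
    have := norm_add_le (S - P) P
    rw [sub_add_cancel] at this
    linarith
  induction r with
  | zero => simp
  | succ r ih =>
    have key : S ^ (r + 1) - P ^ (r + 1) = (S ^ r - P ^ r) * S + P ^ r * (S - P) := by
      rw [pow_succ, pow_succ]; noncomm_ring
    have hPr : ‖P ^ r‖ ≤ 1 := (norm_pow_le P r).trans (pow_le_one₀ (norm_nonneg _) hP)
    have hpos : 0 ≤ (1 + c) ^ r - 1 := (norm_nonneg _).trans ih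
    calc ‖S ^ (r + 1) - P ^ (r + 1)‖ ≤ ‖S ^ r - P ^ r‖ * ‖S‖ + ‖P ^ r‖ * ‖S - P‖ := by
          rw [key]
          exact (norm_add_le _ _).trans (add_le_add (norm_mul_le _ _) (norm_mul_le _ _))
      _ ≤ ((1 + c) ^ r - 1) * (1 + c) + 1 * c := by gcongr
      _ = (1 + c) ^ (r + 1) - 1 := by ring

lemma exp_sub_quadratic_le {x : ℝ} (h0 : 0 ≤ x) (h1 : x ≤ 1) :
    Real.exp x - (1 + x + x ^ 2 / 2) ≤ x ^ 3 := by
  have h := Real.exp_bound' h0 h1 (n := 3) (by norm_num)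
  simp [Finset.sum_range_succ, Nat.factorial] at h
  nlinarith [pow_nonneg h0 3]

lemma one_add_pow_sub_one_le {c : ℝ} (hc : 0 ≤ c) {r : ℕ} (h : r * c ≤ 1) :
    (1 + c) ^ r - 1 ≤ 2 * (r * c) := by
  have h1 : (1 + c) ^ r ≤ Real.exp (r * c) := by
    rw [Real.exp_nat_mul]
    exact pow_le_pow_left₀ (by linarith) (by linarith [Real.add_one_le_exp c]) r
  have h0 : 0 ≤ (r : ℝ) * c := by positivity
  have h2 := Real.abs_exp_sub_one_le (x := r * c) (by rwa [abs_of_nonneg h0])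
  rw [abs_of_nonneg h0] at h2
  linarith [le_abs_self (Real.exp (r * c) - 1)]

end QuadraticApproximation

/-! ### Norms of operators diagonal in an orthonormal basis -/

section Diagonal

variable {E ι : Type*} [NormedAddCommGroup E] [InnerProductSpace ℂ E] [Fintype ι]

lemma norm_le_of_diagonal (b : OrthonormalBasis ι ℂ E) (T : E →L[ℂ] E) (c : ι → ℂ) {C : ℝ}
    (hC : 0 ≤ C) (hT : ∀ i, T (b i) = c i • b i) (hc : ∀ i, ‖c i‖ ≤ C) : ‖T‖ ≤ C := by
  refine T.opNorm_le_bound hC fun v => ?_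
  have h1 : T v = ∑ i, (b.repr v i * c i) • b i := by
    conv_lhs => rw [← b.sum_repr v]
    simp [map_sum, hT, smul_smul]
  have h2 : ∀ i, b.repr (T v) i = b.repr v i * c i := fun i => by
    rw [h1, b.repr_apply_apply, b.orthonormal.inner_right_fintype]
  refine (sq_le_sq₀ (norm_nonneg _) (by positivity)).1 ?_
  rw [mul_pow, ← b.repr.norm_map (T v), ← b.repr.norm_map v, EuclideanSpace.norm_sq_eq,
    EuclideanSpace.norm_sq_eq, Finset.mul_sum]
  refine Finset.sum_le_sum fun i _ => ?_
  rw [h2, norm_mul, mul_pow, mul_comm]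
  gcongr
  exact hc i

end Diagonal

end StoqHBM

namespace StoqHBM

/-! ### Factor graphs: adding a gate and multiplying two graphs -/

section FactorGraphs

variable {n k d N : ℕ}

/-- `f` is the marginal on the `n` visible variables of a product of `N` non-negative factors, each
depending on at most `2 * k` variables, with at most `k * N` hidden variables. A visible variable
occurs in at most `d` factors, a hidden one in at most two. -/
def HasFactorGraph (n k d N : ℕ) (f : (Fin n → Bool) → ℝ) : Prop :=
  ∃ (ι κ : Type) (_ : Fintype ι) (_ : DecidableEq ι) (_ : Fintype κ)
    (s : κ → Finset (Fin n ⊕ ι)) (w : κ → (Fin n ⊕ ι → Bool) → ℝ),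
    Fintype.card ι ≤ k * N ∧ Fintype.card κ ≤ N ∧
    (∀ j, (s j).card ≤ 2 * k) ∧ (∀ j z, 0 ≤ w j z) ∧ (∀ j, DependsOn (w j) (s j)) ∧
    (∀ i, (Finset.univ.filter fun j => Sum.inl i ∈ s j).card ≤ d) ∧
    (∀ i, (Finset.univ.filter fun j => Sum.inr i ∈ s j).card ≤ 2) ∧
    ∀ x, f x = ∑ h : ι → Bool, ∏ j, w j (Sum.elim x h)

lemma hasFactorGraph_one : HasFactorGraph n k d 0 (fun _ => 1) :=
  ⟨Empty, Empty, inferInstance, inferInstance, inferInstance, fun j => j.elim, fun j => j.elim,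
    by simp⟩

/-- The configuration that agrees with `y` on `S` and with `x` elsewhere. -/
def overwrite (S : Finset (Fin n)) (x : Fin n → Bool) (y : {i // i ∈ S} → Bool) : Fin n → Bool :=
  fun i => if h : i ∈ S then y ⟨i, h⟩ else x i

/-- Rename the visible variables in `S` to new hidden variables. -/
def hideOn (S : Finset (Fin n)) (ι : Type) : Fin n ⊕ ι → Fin n ⊕ (ι ⊕ {i // i ∈ S}) :=
  Sum.elim (fun i => if h : i ∈ S then Sum.inr (Sum.inr ⟨i, h⟩) else Sum.inl i)
    (fun a => Sum.inr (Sum.inl a))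

lemma hideOn_injective (S : Finset (Fin n)) (ι : Type) : Function.Injective (hideOn S ι) := by
  rintro (a | a) (b | b) h
  · simp only [hideOn, Sum.elim_inl] at h
    split_ifs at h <;> simp_all
  · simp only [hideOn, Sum.elim_inl, Sum.elim_inr] at h
    split_ifs at h; simp_all
  · simp only [hideOn, Sum.elim_inl, Sum.elim_inr] at h
    split_ifs at h; simp_all
  · simpa [hideOn] using h

lemma elim_comp_hideOn (S : Finset (Fin n)) {ι : Type} (x : Fin n → Bool) (h : ι → Bool)
    (y : {i // i ∈ S} → Bool) :
    Sum.elim x (Sum.elim h y) ∘ hideOn S ι = Sum.elim (overwrite S x y) h := by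
  funext v
  rcases v with i | a
  · by_cases hi : i ∈ S <;> simp [hideOn, overwrite, hi]
  · simp [hideOn]

lemma inl_mem_map_hideOn {S : Finset (Fin n)} {ι : Type} {t : Finset (Fin n ⊕ ι)} {i : Fin n} :
    Sum.inl i ∈ t.map ⟨hideOn S ι, hideOn_injective S ι⟩ ↔ i ∉ S ∧ Sum.inl i ∈ t := by
  rw [Finset.mem_map]
  constructor
  · rintro ⟨v | v, hv, h⟩
    · simp only [hideOn, Function.Embedding.coeFn_mk, Sum.elim_inl] at h
      split_ifs at h with h1
      cases h
      exact ⟨h1, hv⟩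
    · simp [hideOn] at h
  · rintro ⟨hi, ht⟩
    exact ⟨_, ht, by simp [hideOn, hi]⟩

lemma inr_inl_mem_map_hideOn {S : Finset (Fin n)} {ι : Type} {t : Finset (Fin n ⊕ ι)} {a : ι} :
    Sum.inr (Sum.inl a) ∈ t.map ⟨hideOn S ι, hideOn_injective S ι⟩ ↔ Sum.inr a ∈ t :=
  Finset.mem_map' (f := ⟨hideOn S ι, hideOn_injective S ι⟩) (a := Sum.inr a)

lemma inr_inr_mem_map_hideOn {S : Finset (Fin n)} {ι : Type} {t : Finset (Fin n ⊕ ι)}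
    {i : {i // i ∈ S}} :
    Sum.inr (Sum.inr i) ∈ t.map ⟨hideOn S ι, hideOn_injective S ι⟩ ↔ Sum.inl i.1 ∈ t := by
  have h := Finset.mem_map' (f := ⟨hideOn S ι, hideOn_injective S ι⟩) (s := t) (a := Sum.inl i.1)
  rw [← h]
  simp [hideOn, i.2]

lemma DependsOn.comp_rename {α β : Type*} (φ : α ↪ β) {w : (α → Bool) → ℝ} {s : Finset α}
    (hw : DependsOn w s) : DependsOn (fun z : β → Bool => w (z ∘ φ)) (s.map φ) := by
  intro z z' h
  exact hw fun i hi => h _ (by simpa using hi)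

/-- Contraction with a local non-negative gate. -/
lemma HasFactorGraph.apply {f : (Fin n → Bool) → ℝ} (hf : HasFactorGraph n k 1 N f)
    {S : Finset (Fin n)} (hS : S.card ≤ k)
    {B : Matrix ({i // i ∈ S} → Bool) ({i // i ∈ S} → Bool) ℝ} (hB : ∀ x y, 0 ≤ B x y) :
    HasFactorGraph n k 1 (N + 1)
      (fun x => ∑ y, B (fun i => x i.1) y * f (overwrite S x y)) := by
  classical
  obtain ⟨ι, κ, _, _, _, s, w, hι, hκ, hs, hw, hd, h1, h2, hsum⟩ := hf
  let φ : Fin n ⊕ ι ↪ Fin n ⊕ (ι ⊕ {i // i ∈ S}) := ⟨hideOn S ι, hideOn_injective S ι⟩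
  refine ⟨ι ⊕ {i // i ∈ S}, Option κ, inferInstance, inferInstance, inferInstance,
    -- The new gate (`none`) joins the visible variables in `S` to fresh hidden ones that replace
    -- them in the old factors; its scope has `2 * S.card` elements.
    fun j => j.elim (S.disjSum (Finset.univ.map Function.Embedding.inr)) fun j => (s j).map φ,
    fun j z => j.elim (B (fun i => z (Sum.inl i.1)) fun i => z (Sum.inr (Sum.inr i)))
      fun j => w j (z ∘ φ), ?_, ?_, ?_, ?_, ?_, ?_, ?_, ?_⟩
  · simp only [Fintype.card_sum, Fintype.card_coe]
    linarith
  · simpa using hκ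
  · rintro (_ | j)
    · simp only [Option.elim, Finset.card_disjSum, Finset.card_map, Finset.card_univ,
        Fintype.card_coe]
      omega
    · simpa using hs j
  · rintro (_ | j) z
    · exact hB _ _
    · exact hw _ _
  · rintro (_ | j)
    · intro z z' h
      have e1 : (fun i : {i // i ∈ S} => z (Sum.inl i.1)) = fun i => z' (Sum.inl i.1) := by
        funext i; exact h _ (by simp)
      have e2 : (fun i : {i // i ∈ S} => z (Sum.inr (Sum.inr i)))
          = fun i => z' (Sum.inr (Sum.inr i)) := by
        funext i; exact h _ (by simp)
      simp only [Option.elim, e1, e2]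
    · exact DependsOn.comp_rename φ (hd j)
  · intro i
    rw [Finset.card_filter, Fintype.sum_option]
    simp only [Option.elim, Finset.inl_mem_disjSum, φ, inl_mem_map_hideOn]
    by_cases hi : i ∈ S
    · simp [hi]
    · simpa [hi] using h1 i
  · rintro (a | i)
    · rw [Finset.card_filter, Fintype.sum_option]
      simp only [Option.elim, φ, inr_inl_mem_map_hideOn]
      simpa using h2 a
    -- A newly hidden variable was visible in at most one factor and is now also in the gate. This
    -- is why the visible degree is kept at 1.
    · rw [Finset.card_filter, Fintype.sum_option]
      simp only [Option.elim, φ, inr_inr_mem_map_hideOn]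
      have := h1 i.1
      rw [Finset.card_filter] at this
      have hle : ∀ (p : Prop) [Decidable p], (if p then 1 else 0) ≤ 1 := by
        intro p _; split_ifs <;> simp
      exact Nat.add_le_add (hle _) this
  · intro x
    rw [← (Equiv.sumArrowEquivProdArrow ι {i // i ∈ S} Bool).symm.sum_comp, Fintype.sum_prod_type,
      Finset.sum_comm]
    refine Finset.sum_congr rfl fun y _ => ?_
    rw [hsum, Finset.mul_sum]
    refine Finset.sum_congr rfl fun h _ => ?_
    rw [Fintype.prod_option]
    have := elim_comp_hideOn S x h y
    have e : (Equiv.sumArrowEquivProdArrow ι {i // i ∈ S} Bool).symm (h, y) = Sum.elim h y := rfl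
    simp only [Option.elim, e, Sum.elim_inl, Sum.elim_inr, φ, Function.Embedding.coeFn_mk, this]

/-- The product of two factor graphs with disjoint hidden variables. -/
lemma HasFactorGraph.mul {d' N' : ℕ} {f g : (Fin n → Bool) → ℝ} (hf : HasFactorGraph n k d N f)
    (hg : HasFactorGraph n k d' N' g) :
    HasFactorGraph n k (d + d') (N + N') (fun x => f x * g x) := by
  classical
  obtain ⟨ι, κ, _, _, _, s, w, hι, hκ, hs, hw, hd, h1, h2, hsum⟩ := hf
  obtain ⟨ι', κ', _, _, _, s', w', hι', hκ', hs', hw', hd', h1', h2', hsum'⟩ := hg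
  let φ : Fin n ⊕ ι ↪ Fin n ⊕ (ι ⊕ ι') :=
    (Function.Embedding.refl _).sumMap Function.Embedding.inl
  let φ' : Fin n ⊕ ι' ↪ Fin n ⊕ (ι ⊕ ι') :=
    (Function.Embedding.refl _).sumMap Function.Embedding.inr
  refine ⟨ι ⊕ ι', κ ⊕ κ', inferInstance, inferInstance, inferInstance,
    Sum.elim (fun j => (s j).map φ) fun j => (s' j).map φ',
    Sum.elim (fun j z => w j (z ∘ φ)) fun j z => w' j (z ∘ φ'), ?_, ?_, ?_, ?_, ?_, ?_, ?_, ?_⟩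
  · rw [Fintype.card_sum]; linarith
  · rw [Fintype.card_sum]; linarith
  · rintro (j | j)
    · simpa using hs j
    · simpa using hs' j
  · rintro (j | j) z
    · exact hw _ _
    · exact hw' _ _
  · rintro (j | j)
    · exact DependsOn.comp_rename φ (hd j)
    · exact DependsOn.comp_rename φ' (hd' j)
  · intro i
    rw [Finset.card_filter, Fintype.sum_sum_type]
    simpa [φ, φ'] using Nat.add_le_add (h1 i) (h1' i)
  · rintro (a | a)
    · rw [Finset.card_filter, Fintype.sum_sum_type]
      simpa [φ, φ'] using h2 a
    · rw [Finset.card_filter, Fintype.sum_sum_type]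
      simpa [φ, φ'] using h2' a
  · intro x
    simp only
    rw [← (Equiv.sumArrowEquivProdArrow ι ι' Bool).symm.sum_comp, Fintype.sum_prod_type,
      hsum, hsum', Finset.sum_mul_sum]
    refine Finset.sum_congr rfl fun h _ => Finset.sum_congr rfl fun h' _ => ?_
    rw [Fintype.prod_sum_type]
    have e : Sum.elim x ((Equiv.sumArrowEquivProdArrow ι ι' Bool).symm (h, h')) ∘ φ
        = Sum.elim x h := by
      funext v; rcases v with v | v <;> rfl
    have e' : Sum.elim x ((Equiv.sumArrowEquivProdArrow ι ι' Bool).symm (h, h')) ∘ φ'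
        = Sum.elim x h' := by
      funext v; rcases v with v | v <;> rfl
    simp only [Sum.elim_inl, Sum.elim_inr, e, e']

end FactorGraphs

/-! ### Products of local non-negative matrices as factor graphs -/

section Gates

variable {n : ℕ}

/-- `A` is of the form `B ⊗ 1`, where the real matrix `B` acts on the qubits in `S`. -/
def RealActsOn (S : Finset (Fin n)) (A : Matrix (Fin n → Bool) (Fin n → Bool) ℝ) : Prop :=
  ∃ B : Matrix ({i // i ∈ S} → Bool) ({i // i ∈ S} → Bool) ℝ, ∀ x y : Fin n → Bool,
    A x y = if ∀ i, i ∉ S → x i = y i then B (fun i => x i.1) (fun i => y i.1) else 0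

lemma overwrite_apply_mem {S : Finset (Fin n)} (x : Fin n → Bool) (y : {i // i ∈ S} → Bool)
    (i : {i // i ∈ S}) : overwrite S x y i.1 = y i := by simp [overwrite]

lemma overwrite_apply_not_mem {S : Finset (Fin n)} (x : Fin n → Bool) (y : {i // i ∈ S} → Bool)
    {i : Fin n} (hi : i ∉ S) : overwrite S x y i = x i := by simp [overwrite, hi]

/-- A sum over the configurations that agree with `x` off `S`. -/
lemma sum_ite_agree {S : Finset (Fin n)} (x : Fin n → Bool) (g : (Fin n → Bool) → ℝ) :
    (∑ y : Fin n → Bool, if ∀ i, i ∉ S → x i = y i then g y else 0) =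
      ∑ y : {i // i ∈ S} → Bool, g (overwrite S x y) := by
  rw [← Finset.sum_filter]
  symm
  refine Finset.sum_bij (fun y _ => overwrite S x y) ?_ ?_ ?_ ?_
  · intro y _
    simp only [Finset.mem_filter, Finset.mem_univ, true_and]
    exact fun i hi => (overwrite_apply_not_mem x y hi).symm
  · intro y _ y' _ h
    funext i
    rw [← overwrite_apply_mem x y i, h, overwrite_apply_mem]
  · intro y hy
    refine ⟨fun i => y i.1, Finset.mem_univ _, ?_⟩
    funext i
    by_cases hi : i ∈ S
    · exact overwrite_apply_mem x _ ⟨i, hi⟩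
    · rw [overwrite_apply_not_mem _ _ hi]
      exact (Finset.mem_filter.1 hy).2 i hi
  · intros; rfl

lemma realActsOn_one (S : Finset (Fin n)) : RealActsOn S 1 := by
  refine ⟨1, fun x y => ?_⟩
  rw [Matrix.one_apply, Matrix.one_apply, ← ite_and]
  refine if_congr ?_ rfl rfl
  constructor
  · rintro rfl; exact ⟨fun _ _ => rfl, rfl⟩
  · rintro ⟨h1, h2⟩
    funext i
    by_cases hi : i ∈ S
    · exact congrFun h2 ⟨i, hi⟩
    · exact h1 i hi

lemma RealActsOn.add {S : Finset (Fin n)} {A A' : Matrix (Fin n → Bool) (Fin n → Bool) ℝ}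
    (h : RealActsOn S A) (h' : RealActsOn S A') : RealActsOn S (A + A') := by
  obtain ⟨B, hB⟩ := h
  obtain ⟨B', hB'⟩ := h'
  refine ⟨B + B', fun x y => ?_⟩
  rw [Matrix.add_apply, hB, hB']
  split_ifs <;> simp

lemma RealActsOn.smul {S : Finset (Fin n)} {A : Matrix (Fin n → Bool) (Fin n → Bool) ℝ}
    (h : RealActsOn S A) (c : ℝ) : RealActsOn S (c • A) := by
  obtain ⟨B, hB⟩ := h
  refine ⟨c • B, fun x y => ?_⟩
  rw [Matrix.smul_apply, hB]
  split_ifs <;> simp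

lemma RealActsOn.mul {S : Finset (Fin n)} {A A' : Matrix (Fin n → Bool) (Fin n → Bool) ℝ}
    (h : RealActsOn S A) (h' : RealActsOn S A') : RealActsOn S (A * A') := by
  obtain ⟨B, hB⟩ := h
  obtain ⟨B', hB'⟩ := h'
  refine ⟨B * B', fun x y => ?_⟩
  simp only [Matrix.mul_apply, hB, ite_mul, zero_mul]
  rw [sum_ite_agree x fun z => B (fun i => x i.1) (fun i => z i.1) * A' z y]
  simp only [hB', overwrite_apply_mem]
  have : ∀ z : {i // i ∈ S} → Bool, (∀ i, i ∉ S → overwrite S x z i = y i) ↔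
      ∀ i, i ∉ S → x i = y i := fun z =>
    forall₂_congr fun i hi => by rw [overwrite_apply_not_mem x z hi]
  simp only [this]
  split_ifs <;> simp

lemma HasFactorGraph.mulVec {k N : ℕ} {f : (Fin n → Bool) → ℝ} (hf : HasFactorGraph n k 1 N f)
    {S : Finset (Fin n)} (hS : S.card ≤ k) {A : Matrix (Fin n → Bool) (Fin n → Bool) ℝ}
    (hA : RealActsOn S A) (h0 : ∀ x y, 0 ≤ A x y) :
    HasFactorGraph n k 1 (N + 1) (A.mulVec f) := by
  obtain ⟨B, hB⟩ := hA
  -- Each entry of `B` is an entry of `A`, at two configurations extended by the same value off `S`.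
  have hB0 : ∀ x y, 0 ≤ B x y := fun x y => by
    have h := h0 (overwrite S (fun _ => false) x) (overwrite S (fun _ => false) y)
    rw [hB, if_pos fun i hi => by
      rw [overwrite_apply_not_mem _ _ hi, overwrite_apply_not_mem _ _ hi]] at h
    simpa only [overwrite_apply_mem] using h
  convert hf.apply hS hB0 using 1
  funext x
  simp only [Matrix.mulVec, dotProduct, hB, ite_mul, zero_mul]
  rw [sum_ite_agree x fun y => B (fun i => x i.1) (fun i => y i.1) * f y]
  simp only [overwrite_apply_mem]

lemma HasFactorGraph.palindrome {k N : ℕ} {α : Type*} {S : α → Finset (Fin n)}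
    (hS : ∀ a, (S a).card ≤ k) {G : α → Matrix (Fin n → Bool) (Fin n → Bool) ℝ}
    (hG : ∀ a, RealActsOn (S a) (G a)) (h0 : ∀ a x y, 0 ≤ G a x y) (l : List α)
    {f : (Fin n → Bool) → ℝ} (hf : HasFactorGraph n k 1 N f) :
    HasFactorGraph n k 1 (N + 2 * l.length) ((StoqHBM.palindrome G l).mulVec f) := by
  induction l generalizing f N with
  | nil => simpa [StoqHBM.palindrome] using hf
  | cons a l ih =>
    have h := (ih (hf.mulVec (hS a) (hG a) (h0 a))).mulVec (hS a) (hG a) (h0 a)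
    rw [Matrix.mulVec_mulVec, Matrix.mulVec_mulVec] at h
    rw [show N + 2 * (a :: l).length = N + 1 + 2 * l.length + 1 by simp; ring]
    simpa only [StoqHBM.palindrome, Matrix.mul_assoc] using h

lemma HasFactorGraph.pow_mulVec {k M : ℕ} {A : Matrix (Fin n → Bool) (Fin n → Bool) ℝ}
    (hA : ∀ (N : ℕ) (f : (Fin n → Bool) → ℝ), HasFactorGraph n k 1 N f →
      HasFactorGraph n k 1 (N + M) (A.mulVec f)) (r : ℕ) :
    HasFactorGraph n k 1 (r * M) ((A ^ r).mulVec fun _ => 1) := by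
  induction r with
  | zero => simpa using hasFactorGraph_one
  | succ r ih =>
    have h := hA _ _ ih
    rwa [Matrix.mulVec_mulVec, ← pow_succ', ← Nat.succ_mul] at h

end Gates

end StoqHBM

namespace StoqHBM

/-! ### From factor graphs to Hyper Boltzmann Machines -/

section Machines

variable {n m : ℕ}

/-- The machine whose output is the marginal of a product of positive factors; factors with the same
scope are merged. -/
noncomputable def machineOfFactors {κ : Type} [Fintype κ] [DecidableEq κ] (s : κ → Finset (Fin n ⊕ Fin m))
    (w : κ → (Fin n ⊕ Fin m → Bool) → ℝ) : HBM n m where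
  edges := Finset.univ.image s
  localEnergy e y := ∑ j ∈ Finset.univ.filter (fun j => s j = e.1),
    -- The value `false` off the hyperedge is immaterial once `w j` depends only on `s j`.
    -Real.log (w j fun v => if h : v ∈ e.1 then y ⟨v, h⟩ else false)

variable {κ : Type} [Fintype κ] [DecidableEq κ] {s : κ → Finset (Fin n ⊕ Fin m)}
  {w : κ → (Fin n ⊕ Fin m → Bool) → ℝ}

lemma machineOfFactors_energy (hs : ∀ j, DependsOn (w j) (s j)) (x : Fin n → Bool)
    (h : Fin m → Bool) :
    (machineOfFactors s w).energy x h = ∑ j, -Real.log (w j (Sum.elim x h)) := by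
  have h1 : (machineOfFactors s w).energy x h = ∑ e ∈ Finset.univ.image s,
      ∑ j ∈ Finset.univ.filter (fun j => s j = e), -Real.log (w j (Sum.elim x h)) := by
    rw [HBM.energy, ← Finset.sum_coe_sort (Finset.univ.image s)]
    refine Finset.sum_congr rfl fun e _ => Finset.sum_congr rfl fun j hj => ?_
    congr 2
    refine hs j fun v hv => ?_
    rw [(Finset.mem_filter.1 hj).2] at hv
    exact dif_pos (Finset.mem_coe.1 hv)
  rw [h1]
  exact Finset.sum_fiberwise_of_maps_to (fun j _ => Finset.mem_image_of_mem s (Finset.mem_univ j)) _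

lemma machineOfFactors_output (hs : ∀ j, DependsOn (w j) (s j)) (hw : ∀ j z, 0 < w j z)
    (x : Fin n → Bool) :
    (machineOfFactors s w).output x = ∑ h : Fin m → Bool, ∏ j, w j (Sum.elim x h) := by
  refine Finset.sum_congr rfl fun h _ => ?_
  rw [machineOfFactors_energy hs, Finset.sum_neg_distrib, neg_neg, Real.exp_sum]
  exact Finset.prod_congr rfl fun j _ => Real.exp_log (hw _ _)

lemma machineOfFactors_degree_le (v : Fin n ⊕ Fin m) :
    (machineOfFactors s w).degree v ≤ (Finset.univ.filter fun j => v ∈ s j).card := by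
  rw [HBM.degree, machineOfFactors, Finset.filter_image]
  exact Finset.card_image_le

/-- A factor graph whose normalized marginal is strictly `ε`-close to `p` gives rise to a machine
with the same property; vanishing factors are made positive by a small perturbation. -/
lemma HasFactorGraph.exists_machine {k N : ℕ} {f p : (Fin n → Bool) → ℝ} {ε : ℝ}
    (hf : HasFactorGraph n k 2 N f) (hpos : 0 < ∑ x, f x)
    (hp : (1 / 2 : ℝ) * ∑ x, |f x / (∑ y, f y) - p x| < ε) :
    ∃ (m : ℕ) (M : HBM n m), M.IsLocal (2 * k) ∧ m ≤ k * N ∧ M.edges.card ≤ N ∧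
      (∀ v, M.degree v ≤ 2) ∧
      (1 / 2 : ℝ) * ∑ x, |M.output x / (∑ y, M.output y) - p x| ≤ ε := by
  classical
  obtain ⟨ι, κ, _, _, _, s, w, hι, hκ, hs, hw, hd, h1, h2, hsum⟩ := hf
  -- Adding `t > 0` to every factor permits logarithms and changes no scope. The distance to `p` is
  -- continuous at `t = 0`, so the strict inequality survives for small `t`.
  let g : ℝ → (Fin n → Bool) → ℝ := fun t x => ∑ h : ι → Bool, ∏ j, (w j (Sum.elim x h) + t)
  have hg0 : g 0 = f := by
    funext x
    simp only [g, add_zero, hsum]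
  have hg : ∀ x, Continuous fun t => g t x := fun x => by fun_prop
  have hcont : ContinuousAt
      (fun t => (1 / 2 : ℝ) * ∑ x, |g t x / (∑ y, g t y) - p x|) 0 := by
    refine continuousAt_const.mul (tendsto_finsetSum _ fun x _ => ?_)
    refine ContinuousAt.abs (ContinuousAt.sub (ContinuousAt.div (hg x).continuousAt
      (continuous_finsetSum _ fun y _ => hg y).continuousAt ?_) continuousAt_const)
    rw [hg0]
    exact hpos.ne'
  have hev := hcont.eventually_lt (continuousAt_const (y := ε)) (by simpa only [hg0] using hp)
  obtain ⟨t, ht, ht0⟩ := ((hev.filter_mono nhdsWithin_le_nhds).and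
    (self_mem_nhdsWithin : Set.Ioi (0 : ℝ) ∈ nhdsWithin 0 (Set.Ioi 0))).exists
  let e := Fintype.equivFin ι
  let φ : Fin n ⊕ ι ↪ Fin n ⊕ Fin (Fintype.card ι) := (Equiv.sumCongr (Equiv.refl _) e).toEmbedding
  let s' := fun j => (s j).map φ
  let w' : κ → (Fin n ⊕ Fin (Fintype.card ι) → Bool) → ℝ := fun j z => w j (z ∘ φ) + t
  have hd' : ∀ j, DependsOn (w' j) (s' j) := fun j z z' h => by
    have := DependsOn.comp_rename φ (hd j) h
    simp only [w', this]
  have hw' : ∀ j z, 0 < w' j z := fun j z => add_pos_of_nonneg_of_pos (hw _ _) ht0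
  have hout : (machineOfFactors s' w').output = g t := by
    funext x
    rw [machineOfFactors_output hd' hw',
      ← (e.arrowCongr (Equiv.refl Bool)).sum_comp]
    refine Finset.sum_congr rfl fun h _ => Finset.prod_congr rfl fun j _ => ?_
    have : Sum.elim x ((e.arrowCongr (Equiv.refl Bool)) h) ∘ φ = Sum.elim x h := by
      funext v
      rcases v with v | v
      · rfl
      · simp [φ]
    simp only [w', this]
  refine ⟨Fintype.card ι, machineOfFactors s' w', ?_, hι, ?_, ?_, ?_⟩
  · intro e' he'
    obtain ⟨j, -, rfl⟩ := Finset.mem_image.1 he'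
    simpa [s'] using hs j
  · exact Finset.card_image_le.trans hκ
  · intro v
    refine (machineOfFactors_degree_le v).trans ?_
    obtain ⟨v, rfl⟩ := (Equiv.sumCongr (Equiv.refl (Fin n)) e).surjective v
    have : ∀ j, (Equiv.sumCongr (Equiv.refl (Fin n)) e) v ∈ s' j ↔ v ∈ s j := fun j =>
      Finset.mem_map' φ
    simp only [this]
    rcases v with v | v
    · exact h1 v
    · exact h2 v
  · rw [hout]
    exact ht.le

end Machines

/-! ### Total variation distance controlled by the Hilbert space norm -/

section TotalVariation

variable {ι : Type*} [Fintype ι]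

lemma sum_norm_mul_norm_le (u v : EuclideanSpace ℂ ι) : ∑ x, ‖u x‖ * ‖v x‖ ≤ ‖u‖ * ‖v‖ := by
  rw [EuclideanSpace.norm_eq, EuclideanSpace.norm_eq]
  exact Real.sum_mul_le_sqrt_mul_sqrt _ _ _

/-- Factor the difference of squares and apply Cauchy–Schwarz to each of the two resulting sums. -/
lemma totalVariation_le {u ψ : EuclideanSpace ℂ ι} (hu : ‖u‖ = 1) (hψ : ‖ψ‖ = 1) :
    (1 / 2 : ℝ) * ∑ x, |‖u x‖ ^ 2 - ‖ψ x‖ ^ 2| ≤ ‖u - ψ‖ := by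
  have h : ∀ x, |‖u x‖ ^ 2 - ‖ψ x‖ ^ 2| ≤ ‖(u - ψ) x‖ * ‖u x‖ + ‖(u - ψ) x‖ * ‖ψ x‖ := fun x => by
    have h1 : |‖u x‖ - ‖ψ x‖| ≤ ‖(u - ψ) x‖ := abs_norm_sub_norm_le _ _
    have h2 : 0 ≤ ‖u x‖ + ‖ψ x‖ := by positivity
    rw [sq_sub_sq, abs_mul, abs_of_nonneg h2, ← mul_add, mul_comm]
    exact mul_le_mul_of_nonneg_right h1 h2
  have h3 := Finset.sum_le_sum fun x (_ : x ∈ Finset.univ) => h x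
  rw [Finset.sum_add_distrib] at h3
  have h4 := sum_norm_mul_norm_le (u - ψ) u
  have h5 := sum_norm_mul_norm_le (u - ψ) ψ
  rw [hu] at h4
  rw [hψ] at h5
  linarith

/-- The factor 2 is the price of normalization: rescaling `v` to length `η` moves it by `|η - ‖v‖|`,
again at most `η * θ`. The condition `θ < 1` keeps `v` away from zero. -/
lemma totalVariation_normalized_le {v ψ : EuclideanSpace ℂ ι} {η θ : ℝ} (hη : 0 < η)
    (hψ : ‖ψ‖ = 1) (hθ : θ < 1) (h : ‖v - (η : ℂ) • ψ‖ ≤ η * θ) :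
    0 < ‖v‖ ∧ (1 / 2 : ℝ) * ∑ x, |‖v x‖ ^ 2 / ‖v‖ ^ 2 - ‖ψ x‖ ^ 2| ≤ 2 * θ := by
  have hηψ : ‖(η : ℂ) • ψ‖ = η := by
    rw [norm_smul, hψ, Complex.norm_real, Real.norm_of_nonneg hη.le, mul_one]
  have h1 := abs_norm_sub_norm_le v ((η : ℂ) • ψ)
  rw [hηψ] at h1
  have h1' := abs_le.1 (h1.trans h)
  have hv : 0 < ‖v‖ := by nlinarith [h1'.1]
  refine ⟨hv, ?_⟩
  set u : EuclideanSpace ℂ ι := ((‖v‖⁻¹ : ℝ) : ℂ) • v with hu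
  have hu1 : ‖u‖ = 1 := by
    rw [hu, norm_smul, Complex.norm_real, norm_inv, norm_norm, inv_mul_cancel₀ hv.ne']
  have hux : ∀ x, ‖v x‖ ^ 2 / ‖v‖ ^ 2 = ‖u x‖ ^ 2 := fun x => by
    rw [hu, PiLp.smul_apply, norm_smul, Complex.norm_real, norm_inv, norm_norm, mul_pow, inv_pow,
      div_eq_inv_mul]
  simp only [hux]
  refine (totalVariation_le hu1 hψ).trans ?_
  have h2 : ‖(η : ℂ) • u - v‖ = |η - ‖v‖| := by
    have hv' : ((‖v‖ : ℝ) : ℂ) • u = v := by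
      rw [hu, smul_smul, ← Complex.ofReal_mul, mul_inv_cancel₀ hv.ne', Complex.ofReal_one, one_smul]
    have : (η : ℂ) • u - v = ((η - ‖v‖ : ℝ) : ℂ) • u := by
      rw [Complex.ofReal_sub, sub_smul, hv']
    rw [this, norm_smul, hu1, Complex.norm_real, mul_one, Real.norm_eq_abs]
  have h3 : ‖(η : ℂ) • (u - ψ)‖ ≤ 2 * (η * θ) := by
    have : (η : ℂ) • (u - ψ) = ((η : ℂ) • u - v) + (v - (η : ℂ) • ψ) := by rw [smul_sub]; abel
    rw [this]
    refine (norm_add_le _ _).trans ?_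
    rw [h2, abs_sub_comm]
    linarith [h1.trans h]
  rw [norm_smul, Complex.norm_real, Real.norm_of_nonneg hη.le] at h3
  nlinarith

end TotalVariation

end StoqHBM

namespace StoqHBM

/-! ### Spectrum, ground projection and overlap with the uniform state -/

namespace LocalHamiltonian

variable {n k L : ℕ} (H : LocalHamiltonian n k L)

lemma isHermitian_toOp : H.toOp.IsHermitian := by
  rw [toOp, Matrix.IsHermitian, Matrix.conjTranspose_sum]
  exact Finset.sum_congr rfl fun a _ => H.isHermitian a

lemma toOp_apply_eigenvectorBasis (i : Fin n → Bool) :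
    Matrix.toEuclideanCLM (𝕜 := ℂ) H.toOp (H.isHermitian_toOp.eigenvectorBasis i) =
      ((H.isHermitian_toOp.eigenvalues i : ℝ) : ℂ) • H.isHermitian_toOp.eigenvectorBasis i := by
  have h := H.isHermitian_toOp.mulVec_eigenvectorBasis i
  ext x
  rw [Matrix.ofLp_toEuclideanCLM, h]
  simp

lemma eigenvalues_mem_energies (i : Fin n → Bool) :
    H.isHermitian_toOp.eigenvalues i ∈ H.energies := by
  refine Module.End.hasEigenvalue_of_hasEigenvector
    (x := H.isHermitian_toOp.eigenvectorBasis i) ⟨?_, ?_⟩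
  · rw [Module.End.mem_eigenspace_iff]
    exact H.toOp_apply_eigenvectorBasis i
  · exact (H.isHermitian_toOp.eigenvectorBasis.orthonormal.ne_zero i)

variable {J : ℝ}

lemma opNorm_toOp_le (hJ : ∀ a, opNorm (H.term a) ≤ J) : opNorm H.toOp ≤ L * J := by
  rw [opNorm, toOp, map_sum]
  refine (norm_sum_le_of_le _ fun a _ => hJ a).trans ?_
  simp

lemma abs_le_of_mem_energies (hJ : ∀ a, opNorm (H.term a) ≤ J) {E : ℝ} (hE : E ∈ H.energies) :
    |E| ≤ L * J := by
  obtain ⟨v, hv⟩ := Module.End.HasEigenvalue.exists_hasEigenvector hE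
  have h1 : Matrix.toEuclideanCLM (𝕜 := ℂ) H.toOp v = (E : ℂ) • v := hv.apply_eq_smul
  have h2 := (Matrix.toEuclideanCLM (𝕜 := ℂ) H.toOp).le_opNorm v
  rw [h1, norm_smul, Complex.norm_real, Real.norm_eq_abs] at h2
  exact (le_of_mul_le_mul_right h2 (norm_pos_iff.2 hv.2)).trans (H.opNorm_toOp_le hJ)

lemma groundEnergy_le (hJ : ∀ a, opNorm (H.term a) ≤ J) {E : ℝ} (hE : E ∈ H.energies) :
    H.groundEnergy ≤ E :=
  csInf_le ⟨-(L * J), fun _ h => (abs_le.1 (H.abs_le_of_mem_energies hJ h)).1⟩ hE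

lemma neg_le_groundEnergy (hJ : ∀ a, opNorm (H.term a) ≤ J) : -(L * J) ≤ H.groundEnergy :=
  le_csInf ⟨_, H.eigenvalues_mem_energies fun _ => false⟩
    fun _ h => (abs_le.1 (H.abs_le_of_mem_energies hJ h)).1

open Classical in
-- Eigenvectors of a symmetric operator for distinct eigenvalues are orthogonal, so `Π` is diagonal
-- in the eigenbasis and can be compared there with functions of `H`.
lemma groundProj_apply_eigenvectorBasis (i : Fin n → Bool) :
    H.groundProj (H.isHermitian_toOp.eigenvectorBasis i) =
      (if H.isHermitian_toOp.eigenvalues i = H.groundEnergy then (1 : ℂ) else 0) •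
        H.isHermitian_toOp.eigenvectorBasis i := by
  split_ifs with h
  · rw [one_smul]
    refine Submodule.starProjection_eq_self_iff.2 ?_
    rw [groundSpace, Module.End.mem_eigenspace_iff, ← h]
    exact H.toOp_apply_eigenvectorBasis i
  · rw [zero_smul]
    refine (Submodule.starProjection_apply_eq_zero_iff _).2 ?_
    rw [Submodule.mem_orthogonal']
    intro w hw
    rw [groundSpace, Module.End.mem_eigenspace_iff] at hw
    have hs := (Matrix.isSymmetric_toEuclideanLin_iff.2 H.isHermitian_toOp)
      (H.isHermitian_toOp.eigenvectorBasis i) w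
    have h1 : Matrix.toEuclideanLin H.toOp (H.isHermitian_toOp.eigenvectorBasis i) = _ :=
      H.toOp_apply_eigenvectorBasis i
    rw [hw, h1, inner_smul_left, inner_smul_right, Complex.conj_ofReal] at hs
    have h2 : ((H.isHermitian_toOp.eigenvalues i : ℝ) : ℂ) ≠ (H.groundEnergy : ℂ) :=
      fun h' => h (Complex.ofReal_injective h')
    by_contra h3
    exact h2 (mul_right_cancel₀ h3 hs)

end LocalHamiltonian

lemma norm_plusState (n : ℕ) : ‖plusState n‖ = 1 := by
  have h : ‖plusState n‖ ^ 2 = 1 := by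
    rw [EuclideanSpace.norm_sq_eq]
    simp [plusState]
  nlinarith [norm_nonneg (plusState n)]

namespace LocalHamiltonian

variable {n k L : ℕ} (H : LocalHamiltonian n k L)

lemma inner_plusState_groundProj :
    (inner ℂ (plusState n) (H.groundProj (plusState n))).re = ‖H.groundProj (plusState n)‖ ^ 2 := by
  have h : inner ℂ (plusState n) (H.groundProj (plusState n)) =
      inner ℂ (H.groundProj (plusState n)) (H.groundProj (plusState n)) := by
    rw [groundProj, ← Submodule.inner_starProjection_left_eq_right,
      Submodule.inner_starProjection_left_eq_right]
    conv_lhs => rw [← Submodule.starProjection_eq_self_iff.2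
      (Submodule.starProjection_apply_mem H.groundSpace (plusState n))]
    rw [← Submodule.inner_starProjection_left_eq_right]
  rw [h]
  exact inner_self_eq_norm_sq (𝕜 := ℂ) _

lemma overlap_eq_norm : H.overlap = ‖H.groundProj (plusState n)‖ := by
  rw [overlap, inner_plusState_groundProj, Real.sqrt_sq (norm_nonneg _)]

lemma overlap_le_one : H.overlap ≤ 1 := by
  rw [overlap_eq_norm, ← norm_plusState n]
  exact Submodule.norm_starProjection_apply_le _ _

lemma overlap_smul_groundState (h0 : 0 < H.overlap) :
    (H.overlap : ℂ) • H.groundState = H.groundProj (plusState n) := by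
  rw [groundState, smul_smul, ← Complex.ofReal_mul, mul_one_div_cancel h0.ne', Complex.ofReal_one,
    one_smul]

lemma norm_groundState (h0 : 0 < H.overlap) : ‖H.groundState‖ = 1 := by
  have h := congrArg norm (H.overlap_smul_groundState h0)
  rw [norm_smul, Complex.norm_real, Real.norm_of_nonneg h0.le, ← overlap_eq_norm] at h
  exact mul_left_cancel₀ h0.ne' (h.trans (mul_one _).symm)

lemma norm_plusState_sub_groundState_sq (h0 : 0 < H.overlap) :
    ‖plusState n - H.groundState‖ ^ 2 = 2 - 2 * H.overlap := by
  have h : RCLike.re (inner ℂ (plusState n) H.groundState) = H.overlap := by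
    rw [groundState, inner_smul_right, RCLike.re_to_complex, Complex.re_ofReal_mul,
      inner_plusState_groundProj, ← overlap_eq_norm]
    field_simp
  rw [norm_sub_sq (𝕜 := ℂ), norm_plusState, H.norm_groundState h0, h]
  ring

end LocalHamiltonian

end StoqHBM

namespace StoqHBM

/-! ### Real matrices as operators -/

section RealMatrices

variable {n : ℕ}

/-- A real matrix as an operator on the space of `n` qubits. -/
noncomputable def realOp (n : ℕ) :
    Matrix (Fin n → Bool) (Fin n → Bool) ℝ →+* (QubitSpace n →L[ℂ] QubitSpace n) :=
  (RingHomClass.toRingHom (Matrix.toEuclideanCLM (n := Fin n → Bool) (𝕜 := ℂ))).comp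
    Complex.ofRealHom.mapMatrix

lemma realOp_apply (A : Matrix (Fin n → Bool) (Fin n → Bool) ℝ) :
    realOp n A = Matrix.toEuclideanCLM (𝕜 := ℂ) (A.map Complex.ofReal) := rfl

lemma realOp_smul (c : ℝ) (A : Matrix (Fin n → Bool) (Fin n → Bool) ℝ) :
    realOp n (c • A) = (c : ℂ) • realOp n A := by
  rw [realOp_apply, realOp_apply, ← map_smul]
  congr 1
  ext x y
  simp

lemma realOp_quadExp (A : Matrix (Fin n → Bool) (Fin n → Bool) ℝ) :
    realOp n (quadExp ℝ A) = quadExp ℂ (realOp n A) := by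
  simp [quadExp, realOp_smul]

lemma realOp_apply_const (A : Matrix (Fin n → Bool) (Fin n → Bool) ℝ) (c : ℝ) (x : Fin n → Bool) :
    realOp n A (WithLp.toLp 2 fun _ => (c : ℂ)) x = ((c * A.mulVec (fun _ => 1) x : ℝ) : ℂ) := by
  rw [realOp_apply, Matrix.toEuclideanCLM_toLp]
  simp [Matrix.mulVec, dotProduct, Finset.mul_sum, mul_comm]

end RealMatrices

lemma norm_apply_le_opNorm {n : ℕ} (A : QubitOp n) (x y : Fin n → Bool) : ‖A x y‖ ≤ opNorm A := by
  have h1 := (Matrix.toEuclideanCLM (𝕜 := ℂ) A).le_opNorm (EuclideanSpace.single y 1)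
  have h2 := PiLp.norm_apply_le (Matrix.toEuclideanCLM (𝕜 := ℂ) A (EuclideanSpace.single y 1)) x
  rw [Matrix.ofLp_toEuclideanCLM] at h2
  simp at h1 h2
  exact h2.trans h1

/-! ### The product formula for a stoquastic Hamiltonian -/

namespace LocalHamiltonian

variable {n k L : ℕ} (H : LocalHamiltonian n k L) {J Δ : ℝ}

/-- The real matrix `J - Hₐ`. -/
noncomputable def shiftedTerm (J : ℝ) (a : Fin L) : Matrix (Fin n → Bool) (Fin n → Bool) ℝ :=
  J • (1 : Matrix (Fin n → Bool) (Fin n → Bool) ℝ) + (-1 : ℝ) • (H.term a).map Complex.re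

lemma shiftedTerm_nonneg (hs : H.IsStoquastic) (hJ : ∀ a, opNorm (H.term a) ≤ J) (a : Fin L)
    (x y : Fin n → Bool) : 0 ≤ H.shiftedTerm J a x y := by
  by_cases h : x = y
  · subst h
    have h1 := (Complex.abs_re_le_norm (H.term a x x)).trans
      ((norm_apply_le_opNorm (H.term a) x x).trans (hJ a))
    simp [shiftedTerm]
    linarith [(abs_le.1 h1).2]
  · simp [shiftedTerm, Matrix.one_apply_ne h, (hs a x y h).2]

lemma realActsOn_shiftedTerm {S : Finset (Fin n)} {a : Fin L} (h : ActsOn S (H.term a)) :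
    RealActsOn S (H.shiftedTerm J a) := by
  refine ((realActsOn_one S).smul J).add (RealActsOn.smul ?_ _)
  obtain ⟨B, hB⟩ := h
  refine ⟨B.map Complex.re, fun x y => ?_⟩
  rw [Matrix.map_apply, hB]
  split_ifs <;> simp

lemma realOp_shiftedTerm (hs : H.IsStoquastic) (J : ℝ) (a : Fin L) :
    realOp n (H.shiftedTerm J a) =
      (J : ℂ) • 1 - Matrix.toEuclideanCLM (𝕜 := ℂ) (H.term a) := by
  have h : ∀ x y, (((H.term a x y).re : ℝ) : ℂ) = H.term a x y := fun x y => by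
    refine Complex.ext (by simp) ?_
    rw [Complex.ofReal_im]
    by_cases hxy : x = y
    · subst hxy
      have := congrFun (congrFun (H.isHermitian a) x) x
      rw [Matrix.conjTranspose_apply] at this
      exact (Complex.conj_eq_iff_im.1 this).symm
    · exact (hs a x y hxy).1.symm
  have h2 : realOp n ((H.term a).map Complex.re) = Matrix.toEuclideanCLM (𝕜 := ℂ) (H.term a) := by
    rw [realOp_apply]
    congr 1
    ext x y
    exact h x y
  rw [shiftedTerm, map_add, realOp_smul, realOp_smul, h2, map_one]
  ext v x
  simp [sub_eq_add_neg]

lemma norm_realOp_shiftedTerm_le (hs : H.IsStoquastic) (h0 : 0 ≤ J)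
    (hJ : ∀ a, opNorm (H.term a) ≤ J) (a : Fin L) :
    ‖realOp n (H.shiftedTerm J a)‖ ≤ 2 * J := by
  rw [H.realOp_shiftedTerm hs]
  refine (norm_sub_le _ _).trans ?_
  have h1 : ‖(J : ℂ) • (1 : QubitSpace n →L[ℂ] QubitSpace n)‖ ≤ J := by
    rw [norm_smul, Complex.norm_real, Real.norm_of_nonneg h0]
    exact mul_le_of_le_one_right h0 (ContinuousLinearMap.norm_id_le)
  have h2 : ‖Matrix.toEuclideanCLM (𝕜 := ℂ) (H.term a)‖ ≤ J := hJ a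
  linarith

/-- One step of the symmetric product formula for `exp (τ * (L * J - H))`, with each local
exponential replaced by its quadratic Taylor polynomial. -/
noncomputable def productStep (J τ : ℝ) : Matrix (Fin n → Bool) (Fin n → Bool) ℝ :=
  palindrome (fun a => quadExp ℝ ((τ / 2) • H.shiftedTerm J a)) (List.finRange L)

lemma hasFactorGraph_productStep_pow (hs : H.IsStoquastic) (hJ : ∀ a, opNorm (H.term a) ≤ J)
    {τ : ℝ} (hτ : 0 ≤ τ) (r : ℕ) :
    HasFactorGraph n k 1 (r * (2 * L)) ((H.productStep J τ ^ r).mulVec fun _ => 1) := by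
  choose S hS hact using H.isLocal
  refine HasFactorGraph.pow_mulVec (fun N f hf => ?_) r
  have h0 : ∀ a x y, 0 ≤ ((τ / 2) • H.shiftedTerm J a) x y := fun a x y =>
    mul_nonneg (by positivity) (H.shiftedTerm_nonneg hs hJ a x y)
  have h := HasFactorGraph.palindrome hS (G := fun a => quadExp ℝ ((τ / 2) • H.shiftedTerm J a))
    (fun a => ?_) (fun a x y => ?_) (List.finRange L) hf
  · simpa only [List.length_finRange, productStep] using h
  · have h1 := (H.realActsOn_shiftedTerm (J := J) (hact a)).smul (τ / 2)
    exact ((realActsOn_one _).add h1).add ((h1.mul h1).smul _)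
  · have h1 : (0 : ℝ) ≤ (1 : Matrix (Fin n → Bool) (Fin n → Bool) ℝ) x y := by
      rw [Matrix.one_apply]; split_ifs <;> simp
    have h2 : (0 : ℝ) ≤ (((τ / 2) • H.shiftedTerm J a) * ((τ / 2) • H.shiftedTerm J a)) x y := by
      rw [Matrix.mul_apply]
      exact Finset.sum_nonneg fun z _ => mul_nonneg (h0 a x z) (h0 a z y)
    exact add_nonneg (add_nonneg h1 (h0 a x y)) (mul_nonneg (by norm_num) h2)

/-- The operator `τ * (L * J - H)`. -/
noncomputable def shiftedOp (J τ : ℝ) : QubitSpace n →L[ℂ] QubitSpace n :=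
  (τ : ℂ) • (((L * J : ℝ) : ℂ) • 1 - Matrix.toEuclideanCLM (𝕜 := ℂ) H.toOp)

lemma norm_realOp_productStep_sub_le (hs : H.IsStoquastic) (h0 : 0 ≤ J)
    (hJ : ∀ a, opNorm (H.term a) ≤ J) {τ : ℝ} (hτ : 0 ≤ τ) (h1 : 2 * L * J * τ ≤ 1) :
    ‖realOp n (H.productStep J τ) - quadExp ℂ (H.shiftedOp J τ)‖ ≤ (2 * L * J * τ) ^ 3 := by
  have hX : ∀ a, ‖realOp n ((τ / 2) • H.shiftedTerm J a)‖ ≤ τ * J := fun a => by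
    rw [realOp_smul, norm_smul, Complex.norm_real, Real.norm_of_nonneg (by positivity)]
    have := H.norm_realOp_shiftedTerm_le hs h0 hJ a
    nlinarith
  have h := (isQuadApprox_palindrome _ hX (List.finRange L)).norm_sub
  have e1 : palindrome (fun a => quadExp ℂ (realOp n ((τ / 2) • H.shiftedTerm J a)))
      (List.finRange L) = realOp n (H.productStep J τ) := by
    rw [productStep]
    have := map_palindrome (realOp n : _ →* (QubitSpace n →L[ℂ] QubitSpace n))
      (fun a => quadExp ℝ ((τ / 2) • H.shiftedTerm J a)) (List.finRange L)
    simp only [MonoidHom.coe_coe, realOp_quadExp] at this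
    exact this.symm
  have e2 : (2 : ℂ) • ((List.finRange L).map
      fun a => realOp n ((τ / 2) • H.shiftedTerm J a)).sum = H.shiftedOp J τ := by
    rw [← List.ofFn_eq_map, List.sum_ofFn]
    simp only [realOp_smul, H.realOp_shiftedTerm hs]
    rw [← Finset.smul_sum, Finset.sum_sub_distrib, ← map_sum, smul_smul, shiftedOp, toOp,
      Finset.sum_const, Finset.card_univ, Fintype.card_fin, ← Nat.cast_smul_eq_nsmul ℂ, smul_smul]
    congr 1
    · push_cast; ring
    · congr 2
      push_cast; ring
  have e3 : 2 * ((List.finRange L).length : ℝ) * (τ * J) = 2 * L * J * τ := by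
    rw [List.length_finRange]; ring
  rw [e1, e2, e3] at h
  exact h.trans (exp_sub_quadratic_le (by positivity) h1)

lemma quadExp_shiftedOp_apply (J τ : ℝ) (i : Fin n → Bool) :
    quadExp ℂ (H.shiftedOp J τ) (H.isHermitian_toOp.eigenvectorBasis i) =
      ((quadExp ℝ (τ * (L * J - H.isHermitian_toOp.eigenvalues i)) : ℝ) : ℂ) •
        H.isHermitian_toOp.eigenvectorBasis i := by
  have h : H.shiftedOp J τ (H.isHermitian_toOp.eigenvectorBasis i) =
      ((τ * (L * J - H.isHermitian_toOp.eigenvalues i) : ℝ) : ℂ) •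
        H.isHermitian_toOp.eigenvectorBasis i := by
    rw [shiftedOp, smul_apply, sub_apply,
      H.toOp_apply_eigenvectorBasis, smul_apply, one_apply_eq_self,
      ← sub_smul, smul_smul]
    push_cast; rfl
  simp only [quadExp, add_apply, smul_apply,
    one_apply_eq_self, mul_apply_eq_comp, h, map_smul, smul_smul]
  simp only [Complex.ofReal_add, Complex.ofReal_one, smul_eq_mul, Complex.ofReal_mul,
    Complex.ofReal_inv, Complex.ofReal_ofNat, add_smul, one_smul, mul_assoc]

end LocalHamiltonian

lemma quadExp_pos {x : ℝ} (hx : 0 ≤ x) : 0 < quadExp ℝ x := by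
  rw [quadExp_real]; positivity

lemma quadExp_mono {x y : ℝ} (hx : 0 ≤ x) (hxy : x ≤ y) : quadExp ℝ x ≤ quadExp ℝ y := by
  rw [quadExp_real, quadExp_real]; gcongr

/-- The numerator is at least `d` below the denominator, which is at most 3 since `y ≤ 1`; the ratio
is thus at most `1 - d / 3`. -/
lemma quadExp_div_le {x y d : ℝ} (hx : 0 ≤ x) (hd : 0 ≤ d) (hxy : x + d ≤ y) (hy : y ≤ 1) :
    quadExp ℝ x / quadExp ℝ y ≤ Real.exp (-(d / 3)) := by
  have h1 : quadExp ℝ x / quadExp ℝ y ≤ 1 - d / 3 := by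
    rw [div_le_iff₀ (quadExp_pos (by linarith)), quadExp_real, quadExp_real]
    have h2 : x ^ 2 ≤ y ^ 2 := pow_le_pow_left₀ hx (by linarith) 2
    have h3 : d * (1 + y + y ^ 2 / 2) ≤ d * 3 := mul_le_mul_of_nonneg_left (by nlinarith) hd
    linarith
  linarith [Real.add_one_le_exp (-(d / 3))]

/-! ### Convergence to the ground projection and the resulting machine -/

namespace LocalHamiltonian

variable {n k L : ℕ} (H : LocalHamiltonian n k L) {J Δ : ℝ}

/-- The largest eigenvalue of the quadratic Taylor polynomial of `exp (τ * (L * J - H))`. -/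
noncomputable def stepNorm (J τ : ℝ) : ℝ := quadExp ℝ (τ * (L * J - H.groundEnergy))

lemma one_le_stepNorm (hJ : ∀ a, opNorm (H.term a) ≤ J) {τ : ℝ} (hτ : 0 ≤ τ) :
    1 ≤ H.stepNorm J τ := by
  have h1 := (abs_le.1 (H.abs_le_of_mem_energies hJ
    (H.eigenvalues_mem_energies fun _ => false))).2
  have h2 := H.groundEnergy_le hJ (H.eigenvalues_mem_energies fun _ => false)
  have h3 : 0 ≤ τ * (L * J - H.groundEnergy) := mul_nonneg hτ (by linarith)
  rw [stepNorm, quadExp_real]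
  nlinarith

/-- Everything is diagonal in the eigenbasis of `H`: the normalized eigenvalue is 1 on the ground
space, and the gap makes it at most `exp (-(τ * Δ / 3))` elsewhere. The contraction bound lets the
per-step error add up only linearly in `r`. -/
lemma norm_normalized_quadExp_pow_sub_groundProj_le (hJ : ∀ a, opNorm (H.term a) ≤ J)
    (hgap : H.HasGap Δ) {τ : ℝ} (hτ : 0 ≤ τ) (h1 : 2 * L * J * τ ≤ 1) (r : ℕ) :
    ‖(((H.stepNorm J τ)⁻¹ : ℝ) : ℂ) • quadExp ℂ (H.shiftedOp J τ)‖ ≤ 1 ∧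
    ‖((((H.stepNorm J τ)⁻¹ : ℝ) : ℂ) • quadExp ℂ (H.shiftedOp J τ)) ^ r - H.groundProj‖ ≤
      Real.exp (-(τ * Δ / 3)) ^ r := by
  classical
  set b := H.isHermitian_toOp.eigenvectorBasis with hb
  set E := H.isHermitian_toOp.eigenvalues with hE
  set T := (((H.stepNorm J τ)⁻¹ : ℝ) : ℂ) • quadExp ℂ (H.shiftedOp J τ) with hT
  let q : (Fin n → Bool) → ℝ := fun i => quadExp ℝ (τ * (L * J - E i)) / H.stepNorm J τ
  have hg : 0 < H.stepNorm J τ := zero_lt_one.trans_le (H.one_le_stepNorm hJ hτ)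
  have hEle : ∀ i, E i ≤ L * J := fun i =>
    (abs_le.1 (H.abs_le_of_mem_energies hJ (H.eigenvalues_mem_energies i))).2
  have hE0 : ∀ i, H.groundEnergy ≤ E i := fun i =>
    H.groundEnergy_le hJ (H.eigenvalues_mem_energies i)
  have hx : ∀ i, 0 ≤ τ * (L * J - E i) := fun i => mul_nonneg hτ (by linarith [hEle i])
  have hq0 : ∀ i, 0 ≤ q i := fun i => div_nonneg (quadExp_pos (hx i)).le hg.le
  have hq1 : ∀ i, q i ≤ 1 := fun i => by
    refine (div_le_one hg).2 (quadExp_mono (hx i) ?_)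
    exact mul_le_mul_of_nonneg_left (by linarith [hE0 i]) hτ
  have hTb : ∀ i, T (b i) = (q i : ℂ) • b i := fun i => by
    rw [hT, smul_apply, hb, H.quadExp_shiftedOp_apply, smul_smul,
      ← Complex.ofReal_mul, inv_mul_eq_div]
  have hTr : ∀ i, (T ^ r) (b i) = ((q i ^ r : ℝ) : ℂ) • b i := fun i => by
    induction r with
    | zero => simp
    | succ r ih =>
      rw [pow_succ, mul_apply_eq_comp, hTb, map_smul, ih, smul_smul, pow_succ,
        Complex.ofReal_mul, mul_comm]
  refine ⟨norm_le_of_diagonal b T _ zero_le_one hTb fun i => ?_,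
    norm_le_of_diagonal b _ (fun i => ((q i ^ r : ℝ) : ℂ) -
      if E i = H.groundEnergy then (1 : ℂ) else 0) (by positivity) (fun i => ?_) fun i => ?_⟩
  · rw [Complex.norm_real, Real.norm_of_nonneg (hq0 i)]
    exact hq1 i
  · rw [sub_apply, hTr, hb, H.groundProj_apply_eigenvectorBasis, sub_smul]
  · by_cases h : E i = H.groundEnergy
    · have : q i = 1 := by
        simp only [q, h]
        exact div_self hg.ne'
      simp only [this, h, if_true, one_pow, Complex.ofReal_one, sub_self, norm_zero]
      positivity
    · simp only [if_neg h, sub_zero, Complex.norm_real, norm_pow, Real.norm_of_nonneg (hq0 i)]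
      refine pow_le_pow_left₀ (hq0 i) (quadExp_div_le (hx i) (mul_nonneg hτ hgap.1.le) ?_ ?_) r
      · have := hgap.2 _ (H.eigenvalues_mem_energies i) h
        rw [← mul_add]
        exact mul_le_mul_of_nonneg_left (by linarith) hτ
      · have := H.neg_le_groundEnergy hJ
        nlinarith

/-- The symmetric product formula yields a machine with `4 * L * r` hyperedges. -/
lemma exists_machine_of_steps (hs : H.IsStoquastic) (h0 : 0 ≤ J)
    (hJ : ∀ a, opNorm (H.term a) ≤ J) (hgap : H.HasGap Δ) (hη : 0 < H.overlap) {ε : ℝ}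
    (hε : 0 < ε) (hε1 : ε ≤ 1) {τ : ℝ} (hτ : 0 ≤ τ) {r : ℕ} (h1 : 2 * L * J * τ ≤ 1)
    (h2 : r * (2 * L * J * τ) ^ 3 ≤ 1)
    (h3 : 2 * (r * (2 * L * J * τ) ^ 3) + Real.exp (-(τ * Δ / 3)) ^ r ≤ H.overlap * (ε / 4)) :
    ∃ (m : ℕ) (M : HBM n m), M.IsLocal (2 * k) ∧ m ≤ k * (4 * L * r) ∧
      M.edges.card ≤ 4 * L * r ∧ (∀ v, M.degree v ≤ 2) ∧
      M.RepresentsInDistribution H.groundState ε := by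
  set g := H.stepNorm J τ with hg
  have hg1 : 1 ≤ g := H.one_le_stepNorm hJ hτ
  have hg0 : 0 < g := zero_lt_one.trans_le hg1
  obtain ⟨hP1, hPr⟩ := H.norm_normalized_quadExp_pow_sub_groundProj_le hJ hgap hτ h1 r
  rw [← hg] at hP1 hPr
  -- Since `g ≥ 1`, dividing both operators by `g` does not increase their distance.
  have hSP : ‖((g⁻¹ : ℝ) : ℂ) • realOp n (H.productStep J τ) -
      ((g⁻¹ : ℝ) : ℂ) • quadExp ℂ (H.shiftedOp J τ)‖ ≤ (2 * L * J * τ) ^ 3 := by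
    refine (congrArg norm (smul_sub _ _ _)).symm.trans_le ?_
    rw [norm_smul, Complex.norm_real, Real.norm_of_nonneg (by positivity)]
    exact (mul_le_of_le_one_left (norm_nonneg _) (inv_le_one_of_one_le₀ hg1)).trans
      (H.norm_realOp_productStep_sub_le hs h0 hJ hτ h1)
  have hS := (norm_pow_sub_pow_le hP1 hSP r).trans (one_add_pow_sub_one_le (by positivity) h2)
  set f := (H.productStep J τ ^ r).mulVec fun _ => 1 with hf
  set s : ℝ := g⁻¹ ^ r * (1 / Real.sqrt (2 ^ n)) with hsdef
  have hs0 : 0 < s := by positivity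
  set v : QubitSpace n :=
    ((((g⁻¹ : ℝ) : ℂ) • realOp n (H.productStep J τ)) ^ r) (plusState n) with hv
  have hvx : ∀ x, v x = ((s * f x : ℝ) : ℂ) := fun x => by
    rw [hv, smul_pow, ← map_pow, smul_apply, plusState, PiLp.smul_apply,
      realOp_apply_const, hsdef, smul_eq_mul, ← Complex.ofReal_pow, ← Complex.ofReal_mul, mul_assoc]
  have hclose : ‖v - (H.overlap : ℂ) • H.groundState‖ ≤ H.overlap * (ε / 4) := by
    rw [H.overlap_smul_groundState hη, hv, ← sub_apply]
    refine (ContinuousLinearMap.le_opNorm _ _).trans ?_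
    rw [norm_plusState, mul_one, ← sub_add_sub_cancel]
    exact (norm_add_le _ _).trans ((add_le_add hS hPr).trans h3)
  obtain ⟨hv0, htv⟩ := totalVariation_normalized_le hη (H.norm_groundState hη) (by linarith) hclose
  have hnx : ∀ x, ‖v x‖ ^ 2 = s ^ 2 * (f x * f x) := fun x => by
    rw [hvx, Complex.norm_real, Real.norm_eq_abs, sq_abs]; ring
  have hn : ‖v‖ ^ 2 = s ^ 2 * ∑ x, f x * f x := by
    rw [EuclideanSpace.norm_sq_eq, Finset.mul_sum]
    exact Finset.sum_congr rfl fun x _ => hnx x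
  have hsum : 0 < ∑ x, f x * f x :=
    pos_of_mul_pos_right (hn ▸ pow_pos hv0 2) (sq_nonneg s)
  have hgraph := H.hasFactorGraph_productStep_pow hs hJ hτ r
  have hsq := hgraph.mul hgraph
  -- Each of the two copies has `r` steps of `2 * L` gates, as a palindrome uses every term twice.
  rw [← hf, show r * (2 * L) + r * (2 * L) = 4 * L * r by ring] at hsq
  refine hsq.exists_machine hsum (p := fun x => ‖H.groundState x‖ ^ 2) ?_
  -- The target `ε / 4` yields distance `ε / 2`, leaving the strict margin needed for the
  -- perturbation.
  refine lt_of_le_of_lt (le_of_eq ?_) (htv.trans_lt (by linarith : 2 * (ε / 4) < ε))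
  congr 1
  refine Finset.sum_congr rfl fun x _ => ?_
  rw [hnx, hn, mul_div_mul_left _ _ (by positivity)]

end LocalHamiltonian

end StoqHBM

namespace StoqHBM

/-! ### Degenerate cases, choice of parameters and conclusion -/

namespace LocalHamiltonian

variable {n k L : ℕ} (H : LocalHamiltonian n k L) {J Δ : ℝ}

/-- The machine without hyperedges represents every ground state close to `|+⟩`. -/
lemma exists_machine_of_overlap (hη : 0 < H.overlap) {ε : ℝ} (hε : 0 < ε)
    (h : 2 - 2 * H.overlap ≤ ε ^ 2) :
    ∃ M : HBM n 0, M.edges.card = 0 ∧ M.RepresentsInDistribution H.groundState ε := by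
  let M : HBM n 0 := ⟨∅, fun _ _ => 0⟩
  refine ⟨M, rfl, ?_⟩
  have hout : ∀ x, M.output x = 1 := fun x => by
    simp [HBM.output, HBM.energy, M]
  have hplus : ∀ x, M.output x / (∑ y, M.output y) = ‖plusState n x‖ ^ 2 := fun x => by
    simp [hout, plusState]
  rw [HBM.RepresentsInDistribution]
  simp only [hplus]
  refine (totalVariation_le (norm_plusState n) (H.norm_groundState hη)).trans ?_
  refine le_of_sq_le_sq ?_ hε.le
  rw [H.norm_plusState_sub_groundState_sq hη]
  exact h

/-- If the ground space is not everything then the gap is at most the width of the spectrum. -/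
lemma gap_le_of_overlap_lt_one (hJ : ∀ a, opNorm (H.term a) ≤ J) (hgap : H.HasGap Δ)
    (h : H.overlap < 1) : Δ ≤ 2 * (L * J) := by
  classical
  by_cases hE : ∃ i, H.isHermitian_toOp.eigenvalues i ≠ H.groundEnergy
  · obtain ⟨i, hi⟩ := hE
    have h1 := hgap.2 _ (H.eigenvalues_mem_energies i) hi
    have h2 := (abs_le.1 (H.abs_le_of_mem_energies hJ (H.eigenvalues_mem_energies i))).2
    have h3 := H.neg_le_groundEnergy hJ
    linarith
  · push Not at hE
    have h1 : ‖H.groundProj - 1‖ ≤ 0 := by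
      refine norm_le_of_diagonal H.isHermitian_toOp.eigenvectorBasis _ (fun _ => 0) le_rfl
        (fun i => ?_) fun i => by simp
      rw [sub_apply, H.groundProj_apply_eigenvectorBasis, if_pos (hE i)]
      simp
    rw [norm_le_zero_iff, sub_eq_zero] at h1
    rw [overlap_eq_norm, h1, one_apply_eq_self, norm_plusState] at h
    exact absurd h (lt_irrefl _)

end LocalHamiltonian

/-- The maximum of `η ^ 2 * (2 - 2 * η)` on the positive axis is `8 / 27`, at `η = 2 / 3`, and `27 /
8 > e`. -/
lemma half_le_log_inv {η ε : ℝ} (hη : 0 < η) (hε : 0 < ε) (h : ε ^ 2 < 2 - 2 * η) :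
    1 / 2 ≤ Real.log (η⁻¹ * ε⁻¹) := by
  have h1 : (η * ε) ^ 2 ≤ 8 / 27 := by
    nlinarith [mul_nonneg (sq_nonneg (3 * η - 2)) (by linarith : 0 ≤ 3 * η + 1),
      mul_lt_mul_of_pos_left h (pow_pos hη 2)]
  have h2 : Real.exp 1 ≤ ((η * ε)⁻¹) ^ 2 := by
    rw [inv_pow]
    refine le_trans ?_ (inv_anti₀ (by positivity) h1)
    linarith [Real.exp_one_lt_d9]
  have h3 := Real.log_le_log (Real.exp_pos 1) h2
  rw [Real.log_exp, Real.log_pow, mul_inv] at h3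
  push_cast at h3
  linarith

lemma sizeBound_eq {η J Δ ε : ℝ} {L : ℕ} (hη : 0 < η) (hJ : 0 < J) (hΔ : 0 < Δ) (hε : 0 < ε)
    (hL : 0 < L) (hl : 0 < Real.log (η⁻¹ * ε⁻¹)) :
    sizeBound η L J Δ ε =
      L * ((L * J / Δ * Real.log (η⁻¹ * ε⁻¹)) ^ (3 / 2 : ℝ) * (η * ε) ^ (-(1 / 2) : ℝ)) := by
  have hL' : (0 : ℝ) < L := Nat.cast_pos.2 hL
  have e : (L : ℝ) ^ (5 / 2 : ℝ) = L * (L : ℝ) ^ (3 / 2 : ℝ) := by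
    rw [show (5 / 2 : ℝ) = 1 + 3 / 2 by norm_num, Real.rpow_add hL', Real.rpow_one]
  rw [sizeBound, e, Real.mul_rpow (by positivity) hl.le, Real.div_rpow (by positivity) hΔ.le,
    Real.mul_rpow hL'.le hJ.le, Real.mul_rpow hη.le hε.le, Real.rpow_neg hΔ.le]
  ring

lemma sizeBound_nonneg {η J Δ ε : ℝ} {L : ℕ} (hη : 0 < η) (hη1 : η ≤ 1) (hJ : 0 ≤ J) (hΔ : 0 < Δ)
    (hε : 0 < ε) (hε1 : ε ≤ 1) : 0 ≤ sizeBound η L J Δ ε := by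
  have hl : 0 ≤ Real.log (η⁻¹ * ε⁻¹) :=
    Real.log_nonneg (one_le_mul_of_one_le_of_one_le (one_le_inv_iff₀.2 ⟨hη, hη1⟩)
      (one_le_inv_iff₀.2 ⟨hε, hε1⟩))
  rw [sizeBound]
  positivity

/-- The number of steps: with `z = L * J * l / Δ` and `p = η * ε`, the product formula with total
time `18 * l / Δ` and `r` steps is accurate enough. -/
lemma exists_steps {z p : ℝ} (hz : 1 / 4 ≤ z) (hp : 0 < p) (hp1 : p ≤ 1) :
    ∃ r : ℕ, 0 < r ∧ (r : ℝ) ≤ 1008 * (z ^ (3 / 2 : ℝ) * p ^ (-(1 / 2) : ℝ)) ∧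
      16 * (r * (36 * z / r) ^ 3) ≤ p := by
  set Y := z ^ (3 / 2 : ℝ) * p ^ (-(1 / 2) : ℝ) with hY
  have hz0 : 0 < z := by linarith
  have hYpos : 0 < Y := by positivity
  have hY2 : Y ^ 2 * p = z ^ 3 := by
    rw [hY, mul_pow, ← Real.rpow_natCast, ← Real.rpow_natCast (p ^ _), ← Real.rpow_mul hz0.le,
      ← Real.rpow_mul hp.le]
    norm_num
    rw [Real.rpow_neg_one, mul_assoc, inv_mul_cancel₀ hp.ne', mul_one]
  -- This gives `1 ≤ 8 * Y`, so rounding up costs at most `8 * Y`: hence `1008 = 1000 + 8`.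
  have hY8 : 1 / 8 ≤ Y := by
    refine le_of_sq_le_sq ?_ hYpos.le
    have h1 : (1 / 4 : ℝ) ^ 3 ≤ z ^ 3 := pow_le_pow_left₀ (by norm_num) hz 3
    nlinarith [sq_nonneg Y]
  have hr0 : 0 < ⌈1000 * Y⌉₊ := Nat.ceil_pos.2 (by positivity)
  refine ⟨⌈1000 * Y⌉₊, hr0, ?_, ?_⟩
  · have := Nat.ceil_lt_add_one (a := 1000 * Y) (by positivity)
    linarith
  · have hr := Nat.le_ceil (1000 * Y)
    set r : ℝ := (⌈1000 * Y⌉₊ : ℝ)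
    have hr' : 0 < r := Nat.cast_pos.2 hr0
    have h1 : (1000 * Y) ^ 2 ≤ r ^ 2 := pow_le_pow_left₀ (by positivity) hr 2
    -- Here `746496 = 16 * 36 ^ 3`, which is below `1000 ^ 2`.
    have h2 : 16 * (r * (36 * z / r) ^ 3) = 746496 * (Y ^ 2 * p) / r ^ 2 := by
      rw [hY2]; field_simp; ring
    rw [h2, div_le_iff₀ (by positivity)]
    nlinarith [mul_le_mul_of_nonneg_left h1 hp.le, mul_pos hp (pow_pos hYpos 2)]

end StoqHBM

theorem mainTheorem3 :
    ∃ C : ℝ, 0 < C ∧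
      ∀ (n k L : ℕ) (H : StoqHBM.LocalHamiltonian n k L) (J Δ ε : ℝ),
        H.IsStoquastic →
        0 ≤ J → (∀ a, StoqHBM.opNorm (H.term a) ≤ J) →
        H.HasGap Δ →
        0 < H.overlap →
        0 < ε → ε ≤ 1 →
        ∃ (m : ℕ) (M : StoqHBM.HBM n m),
          M.IsLocal (2 * k) ∧
          (m : ℝ) ≤ C * (k * StoqHBM.sizeBound H.overlap L J Δ ε) ∧
          (M.edges.card : ℝ) ≤ C * StoqHBM.sizeBound H.overlap L J Δ ε ∧
          (∀ v, M.degree v ≤ 2) ∧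
          M.RepresentsInDistribution H.groundState ε := by
  -- `4032 = 4 * 1008`, from `4 * L * r` hyperedges with `r` at most `1008` times the size bound
  -- divided by `L`.
  refine ⟨4032, by norm_num, fun n k L H J Δ ε hs h0 hJ hgap hη hε hε1 => ?_⟩
  have hη1 := H.overlap_le_one
  have hB := StoqHBM.sizeBound_nonneg (L := L) hη hη1 h0 hgap.1 hε hε1
  rcases le_or_gt (2 - 2 * H.overlap) (ε ^ 2) with hcase | hcase
  · obtain ⟨M, hM, hrep⟩ := H.exists_machine_of_overlap hη hε hcase
    have hempty := Finset.card_eq_zero.1 hM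
    refine ⟨0, M, ?_, ?_, ?_, fun v => ?_, hrep⟩
    · intro e he
      simp [hempty] at he
    · rw [Nat.cast_zero]; positivity
    · rw [hM, Nat.cast_zero]; positivity
    · simp [StoqHBM.HBM.degree, hempty]
  · have hΔ := hgap.1
    -- In this case `η < 1`, so the gap is at most `2 * (L * J)`; this forces `L` and `J` to be
    -- positive and bounds `z` below.
    have hΔle := H.gap_le_of_overlap_lt_one hJ hgap (by nlinarith [sq_nonneg ε])
    have hl := StoqHBM.half_le_log_inv hη hε hcase
    have hLJ : 0 < (L : ℝ) * J := by linarith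
    have hL : 0 < L := by
      rcases Nat.eq_zero_or_pos L with h | h
      · simp [h] at hLJ
      · exact h
    have hL' : (0 : ℝ) < L := Nat.cast_pos.2 hL
    have hJ0 : 0 < J := (pos_iff_pos_of_mul_pos hLJ).1 hL'
    have hsize := StoqHBM.sizeBound_eq hη hJ0 hΔ hε hL (by linarith)
    set l := Real.log (H.overlap⁻¹ * ε⁻¹) with hldef
    set p := H.overlap * ε with hp
    have hp0 : 0 < p := mul_pos hη hε
    have hp1 : p ≤ 1 := mul_le_one₀ hη1 hε.le hε1
    have hz : 1 / 4 ≤ L * J / Δ * l := by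
      have h1 : 1 / 2 ≤ L * J / Δ := by rw [le_div_iff₀ hΔ]; linarith
      nlinarith
    obtain ⟨r, hr0, hr, hacc⟩ := StoqHBM.exists_steps hz hp0 hp1
    have hr' : (1 : ℝ) ≤ r := Nat.one_le_cast.2 hr0
    have hδ : 2 * L * J * (18 * l / Δ / r) = 36 * (L * J / Δ * l) / r := by
      field_simp; ring
    have hτ : 0 ≤ 18 * l / Δ / r := by positivity
    -- Total time `18 * l / Δ` gives `exp (-6 * l)`: one factor `exp (-l)` is `p`, and the other
    -- five give at most `1 / 8` as `l ≥ 1 / 2`. With `2 * (p / 16)` from the product formula the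
    -- error is `p / 4`.
    have hexp : Real.exp (-(18 * l / Δ / r * Δ / 3)) ^ r ≤ p / 8 := by
      rw [← Real.exp_nat_mul]
      have e1 : (r : ℝ) * -(18 * l / Δ / r * Δ / 3) = -l + -(5 * l) := by field_simp; ring
      have e2 : Real.exp (-l) = p := by
        rw [hldef, ← mul_inv, Real.log_inv, neg_neg, Real.exp_log hp0]
      have e3 : Real.exp (-(5 * l)) ≤ 1 / 8 := by
        rw [Real.exp_neg, one_div]
        refine inv_anti₀ (by norm_num) ?_
        have h6 := Real.exp_le_exp.2 (by linarith : (5 / 2 : ℝ) ≤ 5 * l)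
        have h7 : Real.exp (5 / 2 : ℝ) = Real.exp (5 / 4) ^ 2 := by
          rw [← Real.exp_nat_mul]; norm_num
        have h8 := Real.quadratic_le_exp_of_nonneg (x := (5 / 4 : ℝ)) (by norm_num)
        nlinarith
      rw [e1, Real.exp_add, e2]
      nlinarith
    have hcube : (r : ℝ) * (2 * L * J * (18 * l / Δ / r)) ^ 3 ≤ p / 16 := by
      rw [hδ]; linarith
    have hδ0 : 0 ≤ 2 * L * J * (18 * l / Δ / r) := by positivity
    -- Otherwise `r` times the cube would exceed 1, whereas it is at most `p / 16`.
    have hδ1 : 2 * L * J * (18 * l / Δ / r) ≤ 1 := by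
      by_contra hcon
      push Not at hcon
      have := one_le_pow₀ (n := 3) hcon.le
      nlinarith
    obtain ⟨m, M, hloc, hm, hcard, hdeg, hrep⟩ := H.exists_machine_of_steps hs h0 hJ hgap hη hε hε1
      hτ hδ1 (hcube.trans (by linarith)) (by linarith)
    have hN : ((4 * L * r : ℕ) : ℝ) ≤ 4032 * StoqHBM.sizeBound H.overlap L J Δ ε := by
      rw [hsize]
      push_cast
      nlinarith
    refine ⟨m, M, hloc, ?_, (Nat.cast_le.2 hcard).trans hN, hdeg, hrep⟩
    calc (m : ℝ) ≤ ((k * (4 * L * r) : ℕ) : ℝ) := Nat.cast_le.2 hm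
      _ = k * ((4 * L * r : ℕ) : ℝ) := by push_cast; ring
      _ ≤ k * (4032 * StoqHBM.sizeBound H.overlap L J Δ ε) := by gcongr
      _ = _ := by ring
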